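/- Let $R$ be a commutative ring with identity. For an $R$-module $M$, let $V_n(M)$ be the set of $n$-tuples $(m_1,\dots,m_n)\in M^n$ whose entries generate $M$; the group $\mathrm{GL}_n(R)$, and hence each of its subgroups, acts on $V_n(M)$ from the right by multiplication of row vectors by matrices. Let $E_n(R)$ be the subgroup of $\mathrm{SL}_n(R)$ generated by the elementary matrices, i.e. the matrices that differ from the identity by a single off-diagonal entry, and let $V_n(M)/E_n(R)$ be the set of its orbits. Let $\mathrm{SL}(R)=\bigcup_n \mathrm{SL}_n(R)$ and $E(R)=\bigcup_n E_n(R)$ be the ascending unions along $A\mapsto\begin{pmatrix}A&0\\0&1\end{pmatrix}$, and let $SK_1(R)=\mathrm{SL}(R)/E(R)$ (the subgroup $E(R)$ is normal). The stable rank $\mathrm{sr}(R)\in\{1,2,\dots,\infty\}$ is the least integer $n>0$ such that for every $(m_1,\dots,m_{n+1})\in V_{n+1}(R)$ there is $(r_1,\dots,r_n)\in R^n$ with $(m_1+r_1m_{n+1},\dots,m_n+r_nm_{n+1})\in V_n(R)$. The linear rank $\mathrm{glr}(R)$ is the least integer $n\ge\mu(R)$, where $\mu(R)$ is the minimal number of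 generators of the $R$-module $R$, such that $\mathrm{GL}_k(R)$ acts transitively on $V_k(R)$ for every $k>n$; the ring $R$ is called Hermite if $\mathrm{glr}(R)=1$. Let $(e_1,\dots,e_n)$ denote the canonical basis of $R^n$. **Proposition.** Let $R$ be a Hermite ring. (i) If $l,n\ge 0$ are integers with $n>l+\mathrm{sr}(R)-1$, then $E_n(R)$ acts transitively on $V_n(R^l)$. (ii) Suppose that $\mathrm{sr}(R)\le 2$. Then there are identifications $$V_n(R^n)/E_n(R)\;\simeq\; R^\times\times SK_1(R)\quad\text{for every } n>2,$$ $$V_{n+1}(R^n)/E_{n+1}(R)\;\simeq\; SK_1(R)\quad\text{for every } n\ge 2,$$ that is, there is a bijection from the first orbit set onto $R^\times\times SK_1(R)$ which sends the orbit of $(ue_1,e_2,\dots,e_n)\sigma$ to $(u,[\sigma])$ for all $u\in R^\times$ and $\sigma\in\mathrm{SL}_n(R)$, and there is a bijection from the second orbit set onto $SK_1(R)$ which sends the orbit of $(e_1,\dots,e_n,0)\sigma$ to $[\sigma]$ for all $\sigma\in\mathrm{SL}_{n+1}(R)$, where $[\sigma]$ is the class of $\sigma$ in $SK_1(R)$.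 -/

import Mathlib

open scoped MatrixGroups

universe u v

/-- `V_n(M)`: the generating vectors of length `n` of the `R`-module `M`, i.e. the `n`-tuples
`(m_1, …, m_n)` of elements of `M` whose entries generate `M`. -/
@[ext]
structure GenVec (R : Type u) [CommRing R] (M : Type v) [AddCommGroup M] [Module R M]
    (n : ℕ) where
  /-- the underlying `n`-tuple -/
  vec : Fin n → M
  span_eq_top : Submodule.span R (Set.range vec) = ⊤

namespace GenVec

section

variable {R : Type u} [CommRing R] {M : Type v} [AddCommGroup M] [Module R M] {n : ℕ}

/-- The product `m A` of a row vector `m` over `M` with a square matrix `A` over `R`. -/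
def rowMul (m : Fin n → M) (A : Matrix (Fin n) (Fin n) R) : Fin n → M :=
  fun j => ∑ i, A i j • m i

theorem rowMul_one (m : Fin n → M) : rowMul m (1 : Matrix (Fin n) (Fin n) R) = m := by
  funext j
  simp [rowMul, Matrix.one_apply]

theorem rowMul_mul (m : Fin n → M) (A B : Matrix (Fin n) (Fin n) R) :
    rowMul m (A * B) = rowMul (rowMul m A) B := by
  funext j
  simp only [rowMul, Matrix.mul_apply, Finset.sum_smul, Finset.smul_sum, smul_smul]
  rw [Finset.sum_comm]
  refine Finset.sum_congr rfl fun k _ => Finset.sum_congr rfl fun i _ => ?_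
  rw [mul_comm]

theorem span_rowMul_le (m : Fin n → M) (A : Matrix (Fin n) (Fin n) R) :
    Submodule.span R (Set.range (rowMul m A)) ≤ Submodule.span R (Set.range m) := by
  rw [Submodule.span_le]
  rintro _ ⟨j, rfl⟩
  exact Submodule.sum_mem _ fun i _ =>
    Submodule.smul_mem _ _ (Submodule.subset_span (Set.mem_range_self i))

/-- The right action of `GL_n(R)` on `V_n(M)` by matrix multiplication, written (as usual in
Mathlib) as a left action of the opposite group: `MulOpposite.op g • m` is `m g`. -/
instance : MulAction (GL (Fin n) R)ᵐᵒᵖ (GenVec R M n) where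
  smul g m :=
    { vec := rowMul m.vec (g.unop : Matrix (Fin n) (Fin n) R)
      span_eq_top := by
        have h := span_rowMul_le (rowMul m.vec (g.unop : Matrix (Fin n) (Fin n) R))
          ((g.unop⁻¹ : GL (Fin n) R) : Matrix (Fin n) (Fin n) R)
        rw [← rowMul_mul, Units.mul_inv, rowMul_one, m.span_eq_top] at h
        exact top_le_iff.mp h }
  one_smul m := GenVec.ext (rowMul_one m.vec)
  mul_smul g h m := GenVec.ext (rowMul_mul m.vec _ _)

/-- The right action of `SL_n(R)` on `V_n(M)`, the restriction of that of `GL_n(R)`. -/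
instance : MulAction (Matrix.SpecialLinearGroup (Fin n) R)ᵐᵒᵖ (GenVec R M n) :=
  MulAction.compHom _ (Matrix.SpecialLinearGroup.toGL (n := Fin n) (R := R)).op

theorem op_smul_vec (g : Matrix.SpecialLinearGroup (Fin n) R) (m : GenVec R M n) :
    (MulOpposite.op g • m).vec = rowMul m.vec (g : Matrix (Fin n) (Fin n) R) := rfl

end

end GenVec

/-- `E_n(R)`: the subgroup of `SL_n(R)` generated by the elementary matrices, i.e. the matrices
which differ from the identity by a single off-diagonal entry. -/
def elementaryGroup (R : Type u) [CommRing R] (n : ℕ) :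
    Subgroup (Matrix.SpecialLinearGroup (Fin n) R) :=
  Subgroup.closure {A | ∃ (i j : Fin n) (h : i ≠ j) (r : R),
    A = Matrix.SpecialLinearGroup.transvection h r}

/-- The orbit set `V_n(M) / E_n(R)`. -/
abbrev GenVec.ModE (R : Type u) [CommRing R] (M : Type v) [AddCommGroup M] [Module R M]
    (n : ℕ) : Type v :=
  MulAction.orbitRel.Quotient (elementaryGroup R n).op (GenVec R M n)

/-- The orbit of a generating vector in `V_n(M) / E_n(R)`. -/
def GenVec.toModE {R : Type u} [CommRing R] {M : Type v} [AddCommGroup M] [Module R M]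
    {n : ℕ} (m : GenVec R M n) : GenVec.ModE R M n :=
  Quotient.mk _ m

/-- `μ(M)`: the minimal number of generators of a finitely generated module `M`. -/
noncomputable def minGen (R : Type u) [CommRing R] (M : Type v) [AddCommGroup M] [Module R M]
    [Module.Finite R M] : ℕ :=
  (⊤ : Submodule R M).spanFinrank

/-- The integer `n > 0` lies in the stable range of `M`. -/
def InStableRange (R : Type u) [CommRing R] (M : Type v) [AddCommGroup M] [Module R M]
    (n : ℕ) : Prop :=
  0 < n ∧ ∀ m : GenVec R M (n + 1), ∃ r : Fin n → R,
    Submodule.span R (Set.range fun i : Fin n => m.vec i.castSucc + r i • m.vec (Fin.last n)) = ⊤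

/-- `sr(M)`: the Bass stable rank of `M`, the least integer in the stable range of `M`
(`⊤` if there is none). -/
noncomputable def stableRank (R : Type u) [CommRing R] (M : Type v) [AddCommGroup M]
    [Module R M] [Module.Finite R M] : ℕ∞ :=
  ⨅ (n : ℕ) (_ : InStableRange R M n), (n : ℕ∞)

/-- `glr(M)`: the linear rank of `M`, the least integer `n ≥ μ(M)` such that `GL_k(R)` acts
transitively on `V_k(M)` for every `k > n` (`⊤` if there is none). -/
noncomputable def linearRank (R : Type u) [CommRing R] (M : Type v) [AddCommGroup M]
    [Module R M] [Module.Finite R M] : ℕ∞ :=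
  ⨅ (n : ℕ) (_ : minGen R M ≤ n ∧
    ∀ k : ℕ, n < k → MulAction.IsPretransitive (GL (Fin k) R)ᵐᵒᵖ (GenVec R M k)), (n : ℕ∞)

/-- `R` is a Hermite ring: `glr(R) = 1`. -/
def IsHermiteRing (R : Type u) [CommRing R] : Prop :=
  linearRank R R = 1

namespace SLStable

section

variable {R : Type u} [CommRing R]

/-- The bijection `{1, …, m} ⊔ {1, …, n - m} ≃ {1, …, n}` appending the second interval to the
first one. -/
def blockEquiv {m n : ℕ} (h : m ≤ n) : Fin m ⊕ Fin (n - m) ≃ Fin n :=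
  finSumFinEquiv.trans (finCongr (Nat.add_sub_cancel' h))

/-- The embedding `SL_m(R) → SL_n(R)`, `A ↦ diag(A, 1, …, 1)`, for `m ≤ n`. -/
def extend {m n : ℕ} (h : m ≤ n) :
    Matrix.SpecialLinearGroup (Fin m) R →* Matrix.SpecialLinearGroup (Fin n) R where
  toFun A :=
    ⟨Matrix.reindex (blockEquiv h) (blockEquiv h)
      (Matrix.fromBlocks (A : Matrix (Fin m) (Fin m) R) 0 0 1), by
      rw [Matrix.det_reindex_self, Matrix.det_fromBlocks_zero₂₁, Matrix.det_one, mul_one, A.2]⟩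
  map_one' := by
    apply Subtype.ext
    simp [Matrix.fromBlocks_one]
  map_mul' A B := by
    apply Subtype.ext
    change Matrix.reindex _ _ (Matrix.fromBlocks
      ((A : Matrix (Fin m) (Fin m) R) * (B : Matrix (Fin m) (Fin m) R)) 0 0 1) =
      Matrix.reindex _ _ (Matrix.fromBlocks _ 0 0 1) * Matrix.reindex _ _ (Matrix.fromBlocks _ 0 0 1)
    simp [Matrix.submatrix_mul_equiv, Matrix.fromBlocks_multiply]

theorem extend_apply {m n : ℕ} (h : m ≤ n) (A : Matrix.SpecialLinearGroup (Fin m) R) (a b : Fin n) :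
    extend h A a b = if hab : (a : ℕ) < m ∧ (b : ℕ) < m then A ⟨a, hab.1⟩ ⟨b, hab.2⟩
      else if a = b then 1 else 0 := by
  obtain ⟨a, rfl⟩ := (blockEquiv h).surjective a
  obtain ⟨b, rfl⟩ := (blockEquiv h).surjective b
  simp only [EmbeddingLike.apply_eq_iff_eq]
  change Matrix.reindex (blockEquiv h) (blockEquiv h)
      (Matrix.fromBlocks (A : Matrix (Fin m) (Fin m) R) 0 0 1) _ _ = _
  rw [Matrix.reindex_apply, Matrix.submatrix_apply, Equiv.symm_apply_apply,
    Equiv.symm_apply_apply]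
  rcases a with a | a <;> rcases b with b | b <;> simp [blockEquiv, Matrix.one_apply]

instance directedSystem :
    DirectedSystem (fun n : ℕ => Matrix.SpecialLinearGroup (Fin n) R)
      (fun _ _ h => extend (R := R) h) where
  map_self n A := by
    ext a b
    simp [extend_apply]
  map_map k j i hij hjk A := by
    ext a b
    simp only [extend_apply, Fin.ext_iff]
    split_ifs <;> first | rfl | omega

end

end SLStable

/-- `SL(R) = ⋃ SL_n(R)`, the ascending union (direct limit) along `A ↦ diag(A, 1)`. -/
abbrev StableSL (R : Type u) [CommRing R] : Type u :=
  DirectLimit (fun n : ℕ => Matrix.SpecialLinearGroup (Fin n) R)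
    (fun _ _ h => SLStable.extend (R := R) h)

/-- The natural map `SL_n(R) → SL(R)`. -/
noncomputable def StableSL.of (R : Type u) [CommRing R] (n : ℕ) :
    Matrix.SpecialLinearGroup (Fin n) R →* StableSL R where
  toFun A := ⟦⟨n, A⟩⟧
  map_one' := (DirectLimit.one_def n).symm
  map_mul' A B :=
    (DirectLimit.mul_def (f := fun _ _ h => SLStable.extend (R := R) h) n A B).symm

/-- `E(R) = ⋃ E_n(R)`, the (ascending) union of the images of the `E_n(R)` in `SL(R)`. -/
noncomputable def stableE (R : Type u) [CommRing R] : Subgroup (StableSL R) :=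
  ⨆ n : ℕ, (elementaryGroup R n).map (StableSL.of R n)

namespace SLStable

section

variable {R : Type u} [CommRing R]

theorem of_extend {m n : ℕ} (h : m ≤ n) (A : Matrix.SpecialLinearGroup (Fin m) R) :
    StableSL.of R n (extend h A) = StableSL.of R m A :=
  DirectLimit.mk_apply (F := fun n : ℕ => Matrix.SpecialLinearGroup (Fin n) R)
    (f := fun _ _ h => extend (R := R) h) m n A h

theorem transvection_mem {n : ℕ} {i j : Fin n} (h : i ≠ j) (r : R) :
    Matrix.SpecialLinearGroup.transvection h r ∈ elementaryGroup R n :=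
  Subgroup.subset_closure ⟨i, j, h, r, rfl⟩

theorem extend_transvection {m n : ℕ} (h : m ≤ n) {i j : Fin m} (hij : i ≠ j) (r : R) :
    extend h (Matrix.SpecialLinearGroup.transvection hij r) =
      Matrix.SpecialLinearGroup.transvection
        (fun e => hij (Fin.castLE_injective h e) : Fin.castLE h i ≠ Fin.castLE h j) r := by
  ext a b
  rw [extend_apply]
  simp only [Matrix.SpecialLinearGroup.transvection_coe, Matrix.add_apply, Matrix.one_apply,
    Matrix.single_apply, Fin.ext_iff, Fin.val_castLE]
  have hi := i.2
  have hj := j.2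
  split_ifs <;> first | rfl | omega | simp

theorem col_mem {n : ℕ} {ι : Type*} (s : Finset ι) (f : ι → Fin n) (L : Fin n)
    (hf : ∀ k, f k ≠ L) (c : ι → R) :
    ∃ g ∈ elementaryGroup R n,
      (g : Matrix (Fin n) (Fin n) R) = 1 + ∑ k ∈ s, Matrix.single (f k) L (c k) := by
  classical
  induction s using Finset.induction_on with
  | empty => exact ⟨1, one_mem _, by simp⟩
  | insert a s ha ih =>
    obtain ⟨g, hg, e⟩ := ih
    refine ⟨Matrix.SpecialLinearGroup.transvection (hf a) (c a) * g,
      mul_mem (transvection_mem _ _) hg, ?_⟩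
    rw [Matrix.SpecialLinearGroup.coe_mul, e, Matrix.SpecialLinearGroup.transvection_coe, Finset.sum_insert ha,
      add_mul, one_mul, mul_add, mul_one, Finset.mul_sum]
    rw [Finset.sum_eq_zero (f := fun i => Matrix.single (f a) L (c a) * Matrix.single (f i) L (c i))
      fun k _ => Matrix.single_mul_single_of_ne _ _ _ _ (hf k).symm _]
    abel

theorem row_mem {n : ℕ} {ι : Type*} (s : Finset ι) (f : ι → Fin n) (L : Fin n)
    (hf : ∀ k, f k ≠ L) (c : ι → R) :
    ∃ g ∈ elementaryGroup R n,
      (g : Matrix (Fin n) (Fin n) R) = 1 + ∑ k ∈ s, Matrix.single L (f k) (c k) := by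
  classical
  induction s using Finset.induction_on with
  | empty => exact ⟨1, one_mem _, by simp⟩
  | insert a s ha ih =>
    obtain ⟨g, hg, e⟩ := ih
    refine ⟨Matrix.SpecialLinearGroup.transvection (hf a).symm (c a) * g,
      mul_mem (transvection_mem _ _) hg, ?_⟩
    rw [Matrix.SpecialLinearGroup.coe_mul, e, Matrix.SpecialLinearGroup.transvection_coe, Finset.sum_insert ha,
      add_mul, one_mul, mul_add, mul_one, Finset.mul_sum]
    rw [Finset.sum_eq_zero (f := fun i => Matrix.single L (f a) (c a) * Matrix.single L (f i) (c i))
      fun k _ => Matrix.single_mul_single_of_ne _ _ _ _ (hf a) _]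
    abel

theorem extend_castSucc {n : ℕ} (A : Matrix.SpecialLinearGroup (Fin n) R) (a b : Fin n) :
    extend (Nat.le_succ n) A a.castSucc b.castSucc = A a b := by
  rw [extend_apply, dif_pos ⟨a.2, b.2⟩]
  rfl

theorem extend_castSucc_last {n : ℕ} (A : Matrix.SpecialLinearGroup (Fin n) R) (a : Fin n) :
    extend (Nat.le_succ n) A a.castSucc (Fin.last n) = 0 := by
  rw [extend_apply, dif_neg (by simp), if_neg a.castSucc_ne_last]

theorem extend_last_castSucc {n : ℕ} (A : Matrix.SpecialLinearGroup (Fin n) R) (b : Fin n) :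
    extend (Nat.le_succ n) A (Fin.last n) b.castSucc = 0 := by
  rw [extend_apply, dif_neg (by simp), if_neg b.castSucc_ne_last.symm]

theorem extend_last_last {n : ℕ} (A : Matrix.SpecialLinearGroup (Fin n) R) :
    extend (Nat.le_succ n) A (Fin.last n) (Fin.last n) = 1 := by
  rw [extend_apply, dif_neg (by simp), if_pos rfl]

theorem conj_col_mem {n : ℕ} (A : Matrix.SpecialLinearGroup (Fin n) R) (i : Fin n) (r : R) :
    extend (Nat.le_succ n) A * Matrix.SpecialLinearGroup.transvection i.castSucc_ne_last r *
      (extend (Nat.le_succ n) A)⁻¹ ∈ elementaryGroup R (n + 1) := by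
  obtain ⟨g, hg, e⟩ := col_mem Finset.univ Fin.castSucc (Fin.last n)
    (fun k => k.castSucc_ne_last) fun k => A k i * r
  suffices extend (Nat.le_succ n) A * Matrix.SpecialLinearGroup.transvection i.castSucc_ne_last r =
      g * extend (Nat.le_succ n) A by
    rw [this, mul_inv_cancel_right]
    exact hg
  apply Subtype.ext
  rw [Matrix.SpecialLinearGroup.coe_mul, Matrix.SpecialLinearGroup.coe_mul, e,
    Matrix.SpecialLinearGroup.transvection_coe, mul_add, add_mul, one_mul, mul_one, Finset.sum_mul]
  congr 1
  ext a b
  refine Fin.lastCases ?_ (fun a => ?_) a <;> refine Fin.lastCases ?_ (fun b => ?_) b <;>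
  simp [Matrix.sum_apply, Matrix.mul_apply, Matrix.single_apply, extend_castSucc,
    extend_last_castSucc, extend_last_last,
    Fin.castSucc_ne_last, (Fin.castSucc_ne_last _).symm, ite_and]

theorem conj_row_mem {n : ℕ} (A : Matrix.SpecialLinearGroup (Fin n) R) (j : Fin n) (r : R) :
    (extend (Nat.le_succ n) A)⁻¹ *
      Matrix.SpecialLinearGroup.transvection j.castSucc_ne_last.symm r *
      extend (Nat.le_succ n) A ∈ elementaryGroup R (n + 1) := by
  obtain ⟨g, hg, e⟩ := row_mem Finset.univ Fin.castSucc (Fin.last n)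
    (fun k => k.castSucc_ne_last) fun k => r * A j k
  suffices Matrix.SpecialLinearGroup.transvection j.castSucc_ne_last.symm r *
      extend (Nat.le_succ n) A = extend (Nat.le_succ n) A * g by
    rw [mul_assoc, this, inv_mul_cancel_left]
    exact hg
  apply Subtype.ext
  rw [Matrix.SpecialLinearGroup.coe_mul, Matrix.SpecialLinearGroup.coe_mul, e,
    Matrix.SpecialLinearGroup.transvection_coe, mul_add, add_mul, one_mul, mul_one,
    Finset.mul_sum]
  congr 1
  ext a b
  refine Fin.lastCases ?_ (fun a => ?_) a <;> refine Fin.lastCases ?_ (fun b => ?_) b <;>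
  simp [Matrix.sum_apply, Matrix.mul_apply, Matrix.single_apply, extend_castSucc,
    extend_castSucc_last, extend_last_last,
    Fin.castSucc_ne_last, (Fin.castSucc_ne_last _).symm, ite_and]

theorem transvection_eq {n : ℕ} {i j L : Fin n} (hij : i ≠ j) (hi : i ≠ L) (hj : j ≠ L) (r : R) :
    Matrix.SpecialLinearGroup.transvection hij r =
      Matrix.SpecialLinearGroup.transvection hi r *
      Matrix.SpecialLinearGroup.transvection hj.symm 1 *
      Matrix.SpecialLinearGroup.transvection hi (-r) *
      Matrix.SpecialLinearGroup.transvection hj.symm (-1) := by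
  apply Subtype.ext
  have hneg (a b : Fin n) (x : R) : Matrix.single a b (-x) = -Matrix.single a b x := by
    ext k l
    simp only [Matrix.single_apply, Matrix.neg_apply]
    split_ifs <;> simp
  simp only [Matrix.SpecialLinearGroup.coe_mul, Matrix.SpecialLinearGroup.transvection_coe,
    add_mul, mul_add, one_mul, mul_one, Matrix.single_mul_single_same,
    Matrix.single_mul_single_of_ne _ _ _ _ hij.symm,
    Matrix.single_mul_single_of_ne _ _ _ _ hi.symm,
    Matrix.single_mul_single_of_ne _ _ _ _ hj, hneg, neg_mul, mul_neg, add_zero]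
  abel

/-- Whitehead's lemma, up to one stabilization: conjugates of elementary matrices by elements of
`SL_n(R)` lie in `E_{n+1}(R)`. -/
theorem conj_transvection_mem {n : ℕ} (A : Matrix.SpecialLinearGroup (Fin n) R) {i j : Fin n}
    (hij : i ≠ j) (r : R) :
    extend (Nat.le_succ n) (A * Matrix.SpecialLinearGroup.transvection hij r * A⁻¹) ∈
      elementaryGroup R (n + 1) := by
  have h1 := conj_col_mem A i r
  have h2 := conj_row_mem A⁻¹ j 1
  have h3 := conj_col_mem A i (-r)
  have h4 := conj_row_mem A⁻¹ j (-1)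
  rw [map_inv, inv_inv] at h2 h4
  have h := mul_mem (mul_mem (mul_mem h1 h2) h3) h4
  rw [map_mul, map_mul, map_inv, extend_transvection]
  rw [transvection_eq (L := Fin.last n) _ i.castSucc_ne_last j.castSucc_ne_last r]
  convert h using 1
  group

end

end SLStable

/-- `E(R)` is a normal subgroup of `SL(R)`. -/
instance stableE_normal (R : Type u) [CommRing R] : (stableE R).Normal where
  conj_mem x hx g := by
    suffices h : stableE R ≤ (stableE R).comap (MulAut.conj g).toMonoidHom from h hx
    refine iSup_le fun m => ?_
    rw [Subgroup.map_le_iff_le_comap, elementaryGroup, Subgroup.closure_le]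
    rintro _ ⟨i, j, hij, r, rfl⟩
    obtain ⟨n, A, rfl⟩ := DirectLimit.exists_eq_mk _ g
    change StableSL.of R n A * StableSL.of R m _ * (StableSL.of R n A)⁻¹ ∈ stableE R
    rw [← SLStable.of_extend (le_max_left n m) A, ← SLStable.of_extend (le_max_right n m),
      SLStable.extend_transvection, ← map_inv, ← map_mul, ← map_mul,
      ← SLStable.of_extend (Nat.le_succ _)]
    exact Subgroup.mem_iSup_of_mem _
      (Subgroup.mem_map_of_mem _ (SLStable.conj_transvection_mem _ _ r))

/-- The special Whitehead group `SK_1(R) = SL(R) / E(R)`. -/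
abbrev SK1 (R : Type u) [CommRing R] : Type u :=
  StableSL R ⧸ stableE R

/-- The natural homomorphism `SL_n(R) → SK_1(R)`. -/
noncomputable def SK1.ofSL (R : Type u) [CommRing R] (n : ℕ) :
    Matrix.SpecialLinearGroup (Fin n) R →* SK1 R :=
  (QuotientGroup.mk' (stableE R)).comp (StableSL.of R n)

namespace GenVec

/-- The generating vector `(u e_1, e_2, …, e_n)` of `R^n`, for `u` a unit of `R` and
`(e_1, …, e_n)` the canonical basis. -/
def unitFrame (R : Type u) [CommRing R] (n : ℕ) (u : Rˣ) : GenVec R (Fin n → R) n where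
  vec j := Pi.single j (if (j : ℕ) = 0 then (u : R) else 1)
  span_eq_top := by
    rw [eq_top_iff, ← (Pi.basisFun R (Fin n)).span_eq, Submodule.span_le]
    rintro _ ⟨j, rfl⟩
    have h : Pi.basisFun R (Fin n) j = (if (j : ℕ) = 0 then ((u⁻¹ : Rˣ) : R) else 1) •
        (Pi.single j (if (j : ℕ) = 0 then (u : R) else 1) : Fin n → R) := by
      rw [Pi.basisFun_apply, ← Pi.single_smul]
      split_ifs <;> simp
    rw [h]
    exact Submodule.smul_mem _ _ (Submodule.subset_span ⟨j, rfl⟩)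

/-- The generating vector `(e_1, …, e_n, 0)` of `R^n`. -/
def paddedFrame (R : Type u) [CommRing R] (n : ℕ) : GenVec R (Fin n → R) (n + 1) where
  vec := Fin.snoc (fun j : Fin n => (Pi.single j 1 : Fin n → R)) 0
  span_eq_top := by
    rw [eq_top_iff, ← (Pi.basisFun R (Fin n)).span_eq, Submodule.span_le]
    rintro _ ⟨j, rfl⟩
    exact Submodule.subset_span ⟨j.castSucc, by simp⟩

end GenVec

/-! A generating n-tuple of R^l is an l × n matrix with a right inverse, and E_n(R) acts on it by
column operations. If s lies in the stable range, E_n(R) carries every unimodular row of length n >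
s to (1, 0, …, 0). Treating the rows one after the other brings every right invertible l × n matrix
with l + s ≤ n to (I | 0) (`exists_mul_eq_rectOne`); this gives (i).

For (ii), a right invertible square matrix has a unit u as determinant, so it is diag(u, 1, …, 1)σ
with σ in SL_n(R), and its orbit amounts to u and the coset σE_n(R). A right invertible n × (n+1)
matrix is (I | 0)σ: the row reduction is repeated inside SL, where a unimodular row of length two
can also be reduced. The stabilizer of (I | 0) consists of elementary matrices. What remains is to
compare SL_k(R) modulo E_k(R) with SK_1(R) for k ≥ 3. Surjectivity (`SK1.ofSL_surjective`) is row
reduction again; injectivity (`StableRangeCond.mem_elementaryGroup_of_extend_mem`) is the core.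

For injectivity, column operations turn the last row of [[G, g], [b, c]] into (0, …, 0, 1) and leave
an upper left block K. The operations depend on choices r and y, but whether K is elementary does
not (`StableRangeCond.isElementary_reducedBlock`). The property "K is elementary" survives right
multiplication by each transvection, so it holds on all of E_{n+1}(R). For diag(A, 1) a suitable
choice gives K = A. -/

open Matrix

/-! ### Elementary matrices, unimodular rows and the stable range -/

section ElementaryMatrices

variable {R : Type u} [CommRing R]

/-- A square matrix is elementary if it lies in the subgroup `E_n(R)` of `SL_n(R)`. -/
def IsElementary {n : ℕ} (M : Matrix (Fin n) (Fin n) R) : Prop :=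
  ∃ g ∈ elementaryGroup R n, (g : Matrix (Fin n) (Fin n) R) = M

namespace IsElementary

theorem one {n : ℕ} : IsElementary (1 : Matrix (Fin n) (Fin n) R) :=
  ⟨1, one_mem _, rfl⟩

theorem mul {n : ℕ} {M N : Matrix (Fin n) (Fin n) R} (hM : IsElementary M)
    (hN : IsElementary N) : IsElementary (M * N) := by
  obtain ⟨g, hg, rfl⟩ := hM
  obtain ⟨h, hh, rfl⟩ := hN
  exact ⟨g * h, mul_mem hg hh, rfl⟩

theorem exists_inv {n : ℕ} {M : Matrix (Fin n) (Fin n) R} (hM : IsElementary M) :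
    ∃ N, IsElementary N ∧ M * N = 1 ∧ N * M = 1 := by
  obtain ⟨g, hg, rfl⟩ := hM
  refine ⟨_, ⟨g⁻¹, inv_mem hg, rfl⟩, ?_, ?_⟩
  · rw [← Matrix.SpecialLinearGroup.coe_mul, mul_inv_cancel, Matrix.SpecialLinearGroup.coe_one]
  · rw [← Matrix.SpecialLinearGroup.coe_mul, inv_mul_cancel, Matrix.SpecialLinearGroup.coe_one]

theorem transpose {n : ℕ} {M : Matrix (Fin n) (Fin n) R} (hM : IsElementary M) :
    IsElementary Mᵀ := by
  obtain ⟨g, hg, rfl⟩ := hM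
  induction hg using Subgroup.closure_induction_right with
  | one => simpa using one
  | mul_right x hx y hy ih =>
    obtain ⟨i, j, h, r, rfl⟩ := hy
    rw [Matrix.SpecialLinearGroup.coe_mul, transpose_mul]
    refine mul ⟨_, SLStable.transvection_mem h.symm r, ?_⟩ ih
    simp [Matrix.SpecialLinearGroup.transvection_coe]
  | mul_inv_cancel x hx y hy ih =>
    obtain ⟨i, j, h, r, rfl⟩ := hy
    rw [Matrix.SpecialLinearGroup.coe_mul, transpose_mul]
    refine mul ⟨_, inv_mem (SLStable.transvection_mem h.symm r), ?_⟩ ih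
    have e : (Matrix.SpecialLinearGroup.transvection h.symm r) =
        (Matrix.SpecialLinearGroup.transvection h r).transpose := by
      apply Subtype.ext
      simp [Matrix.SpecialLinearGroup.transvection_coe]
    rw [e, Matrix.SpecialLinearGroup.coe_inv, Matrix.SpecialLinearGroup.coe_inv,
      Matrix.SpecialLinearGroup.coe_transpose, adjugate_transpose]

/-- A product of commuting transvections sharing the row `i`. Acting on the right, it adds `c j`
times column `i` to column `j`. -/
theorem rowShear {n : ℕ} (i : Fin (n + 1)) {c : Fin (n + 1) → R} (hc : c i = 0) :
    IsElementary (1 + vecMulVec (Pi.single i 1) c) := by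
  obtain ⟨g, hg, e⟩ := SLStable.row_mem Finset.univ i.succAbove i
    (fun k => Fin.succAbove_ne i k) fun k => c (i.succAbove k)
  refine ⟨g, hg, e.trans ?_⟩
  congr 1
  ext a b
  rw [Matrix.sum_apply, vecMulVec_apply]
  refine Fin.succAboveCases i ?_ (fun b => ?_) b
  · simp [hc]
  · simp [single_apply, Pi.single_apply, ite_and, eq_comm]

theorem colShear {n : ℕ} (i : Fin (n + 1)) {c : Fin (n + 1) → R} (hc : c i = 0) :
    IsElementary (1 + vecMulVec c (Pi.single i 1)) := by
  simpa [transpose_vecMulVec] using (rowShear i hc).transpose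

end IsElementary

/-- A vector is unimodular if its entries generate the unit ideal. -/
def Unimodular {ι : Type*} [Fintype ι] (a : ι → R) : Prop :=
  ∃ x : ι → R, a ⬝ᵥ x = 1

theorem Unimodular.vecMul {n : ℕ} {a : Fin n → R} (ha : Unimodular a)
    {e : Matrix (Fin n) (Fin n) R} (he : IsElementary e) : Unimodular (a ᵥ* e) := by
  obtain ⟨f, -, hef, -⟩ := he.exists_inv
  obtain ⟨x, hx⟩ := ha
  refine ⟨f *ᵥ x, ?_⟩
  rw [dotProduct_mulVec, vecMul_vecMul, hef, vecMul_one, hx]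

variable (R) in
/-- The stable range condition: the last entry of a unimodular row of length `m + 1` is
superfluous up to adding multiples of it to the other entries. -/
def StableRangeCond (m : ℕ) : Prop :=
  ∀ (a : Fin m → R) (b : R), (∃ x y, a ⬝ᵥ x + b * y = 1) → ∃ r : Fin m → R, Unimodular (a + b • r)

theorem unimodular_iff_span {n : ℕ} (a : Fin n → R) :
    Unimodular a ↔ Submodule.span R (Set.range a) = ⊤ := by
  rw [← Ideal.span, Ideal.eq_top_iff_one, Ideal.span,
    Submodule.mem_span_range_iff_exists_fun]
  simp only [Unimodular, dotProduct, smul_eq_mul, mul_comm]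

theorem InStableRange.stableRangeCond {m : ℕ} (h : InStableRange R R m) :
    StableRangeCond R m := by
  rintro a b ⟨x, y, hxy⟩
  have hu : Unimodular (Fin.snoc a b : Fin (m + 1) → R) :=
    ⟨Fin.snoc x y, by simpa [dotProduct, Fin.sum_univ_castSucc] using hxy⟩
  obtain ⟨r, hr⟩ := h.2 ⟨_, (unimodular_iff_span _).1 hu⟩
  refine ⟨r, (unimodular_iff_span _).2 ?_⟩
  rw [← hr]
  congr 2
  ext i
  simp [mul_comm]

namespace StableRangeCond

/-- The condition is applied to the entries other than `a i`, with `a i * x i + b * y` as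
superfluous entry. The part of the correction coming from `a i` is absorbed into the coefficient of
`a i` in the resulting relation, so `a i` itself need not change. -/
theorem exists_eq_zero {m : ℕ} (h : StableRangeCond R m) (i : Fin (m + 1))
    (a : Fin (m + 1) → R) (b : R) (hab : ∃ x y, a ⬝ᵥ x + b * y = 1) :
    ∃ r : Fin (m + 1) → R, r i = 0 ∧ Unimodular (a + b • r) := by
  obtain ⟨x, y, hxy⟩ := hab
  rw [dotProduct, Fin.sum_univ_succAbove _ i] at hxy
  obtain ⟨r, z, hz⟩ := h (fun k => a (i.succAbove k)) (a i * x i + b * y)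
    ⟨fun k => x (i.succAbove k), 1, by simp only [dotProduct]; linear_combination hxy⟩
  refine ⟨i.insertNth 0 (y • r), by simp, i.insertNth (x i * ∑ k, r k * z k) z, ?_⟩
  rw [dotProduct, Fin.sum_univ_succAbove _ i, ← hz]
  simp only [Pi.add_apply, Pi.smul_apply, Fin.insertNth_apply_same,
    Fin.insertNth_apply_succAbove, smul_eq_mul, mul_zero, add_zero, dotProduct, add_mul,
    Finset.sum_add_distrib, Finset.mul_sum]
  rw [add_left_comm]
  congr 1
  simp only [← Finset.sum_add_distrib]
  exact Finset.sum_congr rfl fun k _ => by ring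

theorem succ {m : ℕ} (h : StableRangeCond R m) : StableRangeCond R (m + 1) := fun a b hab =>
  (h.exists_eq_zero 0 a b hab).imp fun _ hr => hr.2

theorem mono {m n : ℕ} (h : StableRangeCond R m) (hmn : m ≤ n) : StableRangeCond R n := by
  induction n, hmn using Nat.le_induction with
  | base => exact h
  | succ n _ ih => exact ih.succ

/-- Three shears: multiples of the first entry make the tail unimodular, the tail then turns the
first entry into 1, and this 1 clears the tail. -/
theorem exists_isElementary_vecMul_eq {m : ℕ} (h : StableRangeCond R m)
    {a : Fin (m + 1) → R} (ha : Unimodular a) :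
    ∃ e, IsElementary e ∧ a ᵥ* e = Pi.single 0 1 := by
  obtain ⟨x, hx⟩ := ha
  rw [dotProduct, Fin.sum_univ_succ] at hx
  obtain ⟨r, z, hz⟩ := h (fun k => a k.succ) (a 0)
    ⟨fun k => x k.succ, x 0, by simp only [dotProduct]; linear_combination hx⟩
  have h1 := IsElementary.rowShear (0 : Fin (m + 1)) (c := Fin.cons 0 r) (by simp)
  have h2 := IsElementary.colShear (0 : Fin (m + 1)) (c := Fin.cons 0 ((1 - a 0) • z))
    (by simp)
  have h3 := IsElementary.rowShear (0 : Fin (m + 1))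
    (c := Fin.cons 0 (-((fun k => a k.succ) + a 0 • r))) (by simp)
  refine ⟨_, (h1.mul h2).mul h3, ?_⟩
  rw [← vecMul_vecMul, ← vecMul_vecMul]
  have e1 : a ᵥ* (1 + vecMulVec (Pi.single 0 1) (Fin.cons 0 r)) =
      Fin.cons (a 0) ((fun k => a k.succ) + a 0 • r) := by
    rw [vecMul_add, vecMul_one, vecMul_vecMulVec]
    ext k
    refine Fin.cases ?_ (fun k => ?_) k <;> simp
  rw [e1]
  generalize (fun k => a k.succ) + a 0 • r = w at hz
  have e2 : (Fin.cons (a 0) w : Fin (m + 1) → R) ᵥ*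
      (1 + vecMulVec (Fin.cons 0 ((1 - a 0) • z)) (Pi.single 0 1)) = Fin.cons 1 w := by
    rw [vecMul_add, vecMul_one, vecMul_vecMulVec]
    have : (Fin.cons (a 0) w : Fin (m + 1) → R) ⬝ᵥ Fin.cons 0 ((1 - a 0) • z) = 1 - a 0 := by
      simp only [dotProduct, Fin.sum_univ_succ, Fin.cons_zero, Fin.cons_succ] at hz ⊢
      rw [mul_zero, zero_add]
      change w ⬝ᵥ ((1 - a 0) • z) = _
      rw [dotProduct_smul, dotProduct, hz, smul_eq_mul, mul_one]
    rw [this]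
    ext k
    refine Fin.cases ?_ (fun k => ?_) k <;> simp
  rw [e2, vecMul_add, vecMul_one, vecMul_vecMulVec]
  ext k
  refine Fin.cases ?_ (fun k => ?_) k <;> simp

/-- A transvection `1 + z d` with `d z = 0` and `d` unimodular is elementary. -/
theorem isElementary_one_add_vecMulVec {m : ℕ} (h : StableRangeCond R m)
    {z d : Fin (m + 1) → R} (hd : Unimodular d) (hz : d ⬝ᵥ z = 0) :
    IsElementary (1 + vecMulVec z d) := by
  obtain ⟨e, he, hde⟩ := h.exists_isElementary_vecMul_eq hd
  obtain ⟨f, hf, hef, hfe⟩ := he.exists_inv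
  have hdf : d = Pi.single 0 1 ᵥ* f := by rw [← hde, vecMul_vecMul, hef, vecMul_one]
  have h0 : (f *ᵥ z) 0 = 0 := by
    rw [hdf, ← dotProduct_mulVec] at hz
    simpa using hz
  -- In the coordinates given by `e`, the row `d` is the first coordinate row, and the transvection
  -- becomes a column shear.
  have h1 := (he.mul (IsElementary.colShear 0 h0)).mul hf
  rw [mul_add, add_mul, mul_one, hef, mul_vecMulVec, vecMulVec_mul, ← hdf, mulVec_mulVec, hef,
    one_mulVec] at h1
  exact h1

/-- A transvection `1 + x t` with `t x = 0` and `x` unimodular is elementary. -/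
theorem isElementary_one_add_vecMulVec' {m : ℕ} (h : StableRangeCond R m)
    {x t : Fin (m + 1) → R} (hx : Unimodular x) (ht : t ⬝ᵥ x = 0) :
    IsElementary (1 + vecMulVec x t) := by
  rw [dotProduct_comm] at ht
  simpa [transpose_vecMulVec] using (h.isElementary_one_add_vecMulVec hx ht).transpose

/-- For unimodular `d` and `x` there are `x'` with `d x' = 1` and `w` with `w x = 0` and
`w x' = 1`. -/
theorem exists_dotProduct_eq_one {m : ℕ} (h : StableRangeCond R m)
    {d x : Fin (m + 1) → R} (hd : Unimodular d) (hx : Unimodular x) :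
    ∃ x' w : Fin (m + 1) → R, d ⬝ᵥ x' = 1 ∧ w ⬝ᵥ x = 0 ∧ w ⬝ᵥ x' = 1 := by
  obtain ⟨e, he, hde⟩ := h.exists_isElementary_vecMul_eq hd
  obtain ⟨f, hf, hef, hfe⟩ := he.exists_inv
  obtain ⟨q, hq⟩ := hx
  have hq' : (f *ᵥ x) ⬝ᵥ (q ᵥ* e) = 1 := by
    rw [dotProduct_comm, ← dotProduct_mulVec, mulVec_mulVec, hef, one_mulVec, dotProduct_comm, hq]
  generalize hX : f *ᵥ x = X at hq'
  have hxX : x = e *ᵥ X := by rw [← hX, mulVec_mulVec, hef, one_mulVec]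
  rw [dotProduct, Fin.sum_univ_succ] at hq'
  obtain ⟨ξ, p, hp⟩ := h (fun k => X k.succ) (X 0)
    ⟨fun k => (q ᵥ* e) k.succ, (q ᵥ* e) 0, by simp only [dotProduct]; linear_combination hq'⟩
  -- The problem is now the one with `d` the first coordinate row and `X` in place of `x`. The form
  -- of `W` gives `W ⬝ᵥ Y = 1` for every `w''`, while `W ⬝ᵥ X` is `X 0` plus `w''` applied to the
  -- unimodular tail inverted by `p`; this choice of `w''` makes it vanish.
  let w'' : Fin m → R := -(X 0) • p
  let W : Fin (m + 1) → R := Fin.cons (1 + w'' ⬝ᵥ ξ) w''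
  let Y : Fin (m + 1) → R := Fin.cons 1 (-ξ)
  refine ⟨e *ᵥ Y, W ᵥ* f, ?_, ?_, ?_⟩
  · rw [dotProduct_mulVec, hde]
    simp [Y]
  · rw [hxX, ← dotProduct_mulVec, mulVec_mulVec, hfe, one_mulVec]
    have hp' : w'' ⬝ᵥ ((fun k => X k.succ) + X 0 • ξ) = - X 0 := by
      rw [smul_dotProduct, dotProduct_comm, hp, smul_eq_mul, mul_one]
    rw [dotProduct_add, dotProduct_smul, smul_eq_mul] at hp'
    rw [dotProduct, Fin.sum_univ_succ]
    simp only [W, Fin.cons_zero, Fin.cons_succ]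
    change _ + w'' ⬝ᵥ (fun k => X k.succ) = 0
    linear_combination hp'
  · rw [← dotProduct_mulVec, mulVec_mulVec, hfe, one_mulVec]
    rw [dotProduct, Fin.sum_univ_succ]
    simp only [W, Y, Fin.cons_zero, Fin.cons_succ]
    change _ + w'' ⬝ᵥ (-ξ) = 1
    rw [dotProduct_neg]
    ring

end StableRangeCond

end ElementaryMatrices

/-! ### Injective stability for SL_n / E_n -/

section InjectiveStability

variable {R : Type u} [CommRing R]

/-- The upper left block of the matrix obtained from `[[G, g], [b, c]]` by adding `r` times the
last column to the first ones, then subtracting `y` times these from the last one, and then clearing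
the last row, when `(b + c r) y = c - 1`. -/
def reducedBlock {n : ℕ} (G : Matrix (Fin n) (Fin n) R) (g b : Fin n → R) (c : R)
    (r y : Fin n → R) : Matrix (Fin n) (Fin n) R :=
  (G + vecMulVec g r) * (1 + vecMulVec y (b + c • r)) - vecMulVec g (b + c • r)

theorem reducedBlock_eq {n : ℕ} (G : Matrix (Fin n) (Fin n) R) (g b : Fin n → R) (c : R)
    (r y : Fin n → R) :
    reducedBlock G g b c r y = G + vecMulVec g r + vecMulVec (G *ᵥ y) (b + c • r) +
      (r ⬝ᵥ y - 1) • vecMulVec g (b + c • r) := by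
  rw [reducedBlock, mul_add, mul_one, add_mul, mul_vecMulVec, vecMulVec_mul_vecMulVec,
    vecMulVec_smul, sub_smul, one_smul]
  abel

/-- Write d = b + c r and v = y' - y. Since d v = 0, the old block sends v to (G + g r) v, and the
two blocks differ by (G + g r) v d. -/
theorem reducedBlock_change_right {n : ℕ} (G : Matrix (Fin n) (Fin n) R) (g b : Fin n → R) (c : R)
    (r y y' : Fin n → R) (hy : (b + c • r) ⬝ᵥ y = c - 1) (hy' : (b + c • r) ⬝ᵥ y' = c - 1) :
    reducedBlock G g b c r y' =
      reducedBlock G g b c r y * (1 + vecMulVec (y' - y) (b + c • r)) := by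
  rw [reducedBlock_eq, reducedBlock_eq]
  generalize b + c • r = d at hy hy'
  simp only [mul_add, add_mul, mul_one, mul_vecMulVec, vecMulVec_mulVec, op_smul_eq_smul, smul_mul_assoc,
    mulVec_sub, hy, hy', sub_self]
  ext i j
  simp only [Matrix.add_apply, Matrix.smul_apply, vecMulVec_apply, Pi.sub_apply, Pi.smul_apply,
    Pi.zero_apply, smul_eq_mul]
  ring

/-- The old block sends y to c (G + g r) y - (c - 1) g, and because t y = 0 the change of the block
is this column times t. -/
theorem reducedBlock_change_left {n : ℕ} (G : Matrix (Fin n) (Fin n) R) (g b : Fin n → R) (c : R)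
    (r t y : Fin n → R) (hy : (b + c • r) ⬝ᵥ y = c - 1) (ht : t ⬝ᵥ y = 0) :
    reducedBlock G g b c (r + t) y = reducedBlock G g b c r y * (1 + vecMulVec y t) := by
  rw [reducedBlock_eq, reducedBlock_eq]
  have hd : b + c • (r + t) = (b + c • r) + c • t := by rw [smul_add, add_assoc]
  rw [hd]
  generalize b + c • r = d at hy
  simp only [mul_add, add_mul, mul_one, mul_vecMulVec, vecMulVec_mulVec, op_smul_eq_smul, smul_mul_assoc,
    add_dotProduct, hy, ht]
  ext i j
  simp only [Matrix.add_apply, Matrix.smul_apply, vecMulVec_apply, Pi.add_apply, Pi.smul_apply, smul_eq_mul]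
  ring

/-- The matrix `[[G, g], [b, c]]` reduces to an elementary matrix by column operations which
involve the last row or column. -/
def ReducesToElementary {n : ℕ} (G : Matrix (Fin n) (Fin n) R) (g b : Fin n → R) (c : R) : Prop :=
  ∃ r y, Unimodular (b + c • r) ∧ (b + c • r) ⬝ᵥ y = c - 1 ∧
    IsElementary (reducedBlock G g b c r y)

namespace StableRangeCond

variable {m : ℕ}

/-- Whether the reduced block is elementary does not depend on the choice of the reduction. -/
theorem isElementary_reducedBlock (h : StableRangeCond R m)
    {G : Matrix (Fin (m + 1)) (Fin (m + 1)) R} {g b : Fin (m + 1) → R} {c : R}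
    (hG : ReducesToElementary G g b c) {r y : Fin (m + 1) → R} (hr : Unimodular (b + c • r))
    (hy : (b + c • r) ⬝ᵥ y = c - 1) : IsElementary (reducedBlock G g b c r y) := by
  have changeY {r y y' : Fin (m + 1) → R} (hr : Unimodular (b + c • r))
      (hy : (b + c • r) ⬝ᵥ y = c - 1) (hy' : (b + c • r) ⬝ᵥ y' = c - 1)
      (hK : IsElementary (reducedBlock G g b c r y)) :
      IsElementary (reducedBlock G g b c r y') := by
    rw [reducedBlock_change_right G g b c r y y' hy hy']
    exact hK.mul (h.isElementary_one_add_vecMulVec hr (by rw [dotProduct_sub, hy, hy', sub_self]))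
  have changeR {r r' x : Fin (m + 1) → R} (hx : (b + c • r) ⬝ᵥ x = 1)
      (ht : (r' - r) ⬝ᵥ x = 0) (hK : IsElementary (reducedBlock G g b c r ((c - 1) • x))) :
      IsElementary (reducedBlock G g b c r' ((c - 1) • x)) := by
    have e : r' = r + (r' - r) := by abel
    rw [e, reducedBlock_change_left G g b c r (r' - r) _
      (by rw [dotProduct_smul, hx, smul_eq_mul, mul_one]) (by rw [dotProduct_smul, ht, smul_zero])]
    refine hK.mul ?_
    -- The column `(c - 1) • x` need not be unimodular; moving the scalar onto the row leaves the
    -- unimodular column `x`.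
    rw [smul_vecMulVec, ← vecMulVec_smul]
    exact h.isElementary_one_add_vecMulVec' ⟨_, by rwa [dotProduct_comm]⟩
      (by rw [smul_dotProduct, ht, smul_zero])
  obtain ⟨r₁, y₁, hr₁, hy₁, hK⟩ := hG
  obtain ⟨x, hx⟩ := hr
  -- The row `w` serves to interpolate: `r₃` below agrees with `r₁` on `x₁` and with `r` on `x`, so
  -- both passages `r₁` to `r₃` and `r₃` to `r` are covered by `changeR`.
  obtain ⟨x₁, w, hx₁, hw, hw₁⟩ :=
    h.exists_dotProduct_eq_one hr₁ (x := x) ⟨_, by rwa [dotProduct_comm]⟩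
  have scale {r x : Fin (m + 1) → R} (hx : (b + c • r) ⬝ᵥ x = 1) :
      (b + c • r) ⬝ᵥ ((c - 1) • x) = c - 1 := by
    rw [dotProduct_smul, hx, smul_eq_mul, mul_one]
  have hwx : ((r - ((r - r₁) ⬝ᵥ x₁) • w) - r₁) ⬝ᵥ x₁ = 0 := by
    rw [sub_right_comm, sub_dotProduct, smul_dotProduct, hw₁, smul_eq_mul, mul_one, sub_self]
  have hwx' : (r - (r - ((r - r₁) ⬝ᵥ x₁) • w)) ⬝ᵥ x = 0 := by
    rw [sub_sub_cancel, smul_dotProduct, hw, smul_zero]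
  generalize r - ((r - r₁) ⬝ᵥ x₁) • w = r₃ at hwx hwx'
  have hx₃ : (b + c • r₃) ⬝ᵥ x₁ = 1 := by
    rw [← hx₁]
    simp only [sub_dotProduct, add_dotProduct, smul_dotProduct, smul_eq_mul] at hwx ⊢
    linear_combination c * hwx
  have hx₃' : (b + c • r₃) ⬝ᵥ x = 1 := by
    rw [← hx]
    simp only [sub_dotProduct, add_dotProduct, smul_dotProduct, smul_eq_mul] at hwx' ⊢
    linear_combination -c * hwx'
  -- From the inside out, with k = c - 1: (r₁, y₁), (r₁, k x₁), (r₃, k x₁), (r₃, k x), (r, k x), (r,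
  -- y).
  exact changeY ⟨x, hx⟩ (scale hx) hy (changeR hx₃' hwx' (changeY ⟨x, hx₃'⟩ (scale hx₃)
    (scale hx₃') (changeR hx₁ hwx (changeY hr₁ hy₁ (scale hx₁) hK))))

end StableRangeCond

namespace ReducesToElementary

variable {n : ℕ} {G : Matrix (Fin n) (Fin n) R} {g b : Fin n → R} {c : R}

/-- The choice (r e, e⁻¹ y) multiplies the reduced block by e on the right. -/
theorem mul_left_block (h : ReducesToElementary G g b c) {e : Matrix (Fin n) (Fin n) R}
    (he : IsElementary e) : ReducesToElementary (G * e) g (b ᵥ* e) c := by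
  obtain ⟨r, y, hr, hy, hK⟩ := h
  obtain ⟨f, -, hef, -⟩ := he.exists_inv
  have hd : b ᵥ* e + c • (r ᵥ* e) = (b + c • r) ᵥ* e := by rw [add_vecMul, smul_vecMul]
  refine ⟨r ᵥ* e, f *ᵥ y, ?_, ?_, ?_⟩
  · rw [hd]
    exact hr.vecMul he
  · rw [hd, dotProduct_mulVec, vecMul_vecMul, hef, vecMul_one, hy]
  · have : reducedBlock (G * e) g (b ᵥ* e) c (r ᵥ* e) (f *ᵥ y) =
        reducedBlock G g b c r y * e := by
      rw [reducedBlock_eq, reducedBlock_eq, hd, mulVec_mulVec, mul_assoc G, hef, mul_one,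
        dotProduct_mulVec, vecMul_vecMul, hef, vecMul_one]
      simp only [add_mul, smul_mul_assoc, vecMulVec_mul]
    rw [this]
    exact hK.mul he

/-- Replacing r by r - t compensates for the operation and leaves the reduced block unchanged. -/
theorem add_last_col (h : ReducesToElementary G g b c) (t : Fin n → R) :
    ReducesToElementary (G + vecMulVec g t) g (b + c • t) c := by
  obtain ⟨r, y, hr, hy, hK⟩ := h
  have hd : b + c • t + c • (r - t) = b + c • r := by
    rw [add_assoc, ← smul_add, add_sub_cancel]
  refine ⟨r - t, y, by rwa [hd], by rwa [hd], ?_⟩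
  have : reducedBlock (G + vecMulVec g t) g (b + c • t) c (r - t) y =
      reducedBlock G g b c r y := by
    rw [reducedBlock, reducedBlock, hd, add_assoc, ← vecMulVec_add, add_sub_cancel]
  rwa [this]

end ReducesToElementary

/-- This operation changes c, so r cannot simply be carried along. Independence of the choices
allows r with r i = 0; for z = s e_i the row d = b + c r and the reduced block are then both
multiplied by the shear 1 + z r. -/
theorem StableRangeCond.reducesToElementary_add_col {m : ℕ} (h : StableRangeCond R m)
    {G : Matrix (Fin (m + 1)) (Fin (m + 1)) R} {g b : Fin (m + 1) → R} {c : R}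
    (hG : ReducesToElementary G g b c) (i : Fin (m + 1)) (s : R) :
    ReducesToElementary G (g + G *ᵥ Pi.single i s) b (c + b ⬝ᵥ Pi.single i s) := by
  obtain ⟨r, hri, hr⟩ := h.exists_eq_zero i b c (by
    obtain ⟨r, -, ⟨x, hx⟩, -⟩ := hG
    refine ⟨x, r ⬝ᵥ x, ?_⟩
    rwa [add_dotProduct, smul_dotProduct, smul_eq_mul] at hx)
  obtain ⟨x, hx⟩ := hr
  have hy : (b + c • r) ⬝ᵥ ((c - 1) • x) = c - 1 := by
    rw [dotProduct_smul, hx, smul_eq_mul, mul_one]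
  have hK := h.isElementary_reducedBlock hG ⟨x, hx⟩ hy
  generalize (c - 1) • x = y at hy hK
  have hrz : r ⬝ᵥ Pi.single i s = 0 := by simp [hri]
  have he : IsElementary (1 + vecMulVec (Pi.single i s) r) := by
    have e : (Pi.single i s : Fin (m + 1) → R) = s • Pi.single i 1 := by
      rw [← Pi.single_smul, smul_eq_mul, mul_one]
    rw [e, smul_vecMulVec, ← vecMulVec_smul]
    exact IsElementary.rowShear i (by simp [hri])
  generalize (Pi.single i s : Fin (m + 1) → R) = z at hrz he
  have hd : b + (c + b ⬝ᵥ z) • r = (b + c • r) ᵥ* (1 + vecMulVec z r) := by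
    rw [vecMul_add, vecMul_one, vecMul_vecMulVec, add_dotProduct, smul_dotProduct, hrz, smul_zero,
      add_zero, add_smul, add_assoc]
  -- The new `y` is (1 + z r)⁻¹ (y + z), where the inverse is 1 - z r because r z = 0.
  have hdy : (b + (c + b ⬝ᵥ z) • r) ⬝ᵥ (y + z - (r ⬝ᵥ y) • z) = c + b ⬝ᵥ z - 1 := by
    simp only [add_dotProduct, smul_dotProduct, smul_eq_mul, dotProduct_add, dotProduct_sub,
      dotProduct_smul, hrz] at hy ⊢
    linear_combination hy
  refine ⟨r, y + z - (r ⬝ᵥ y) • z, ?_, hdy, ?_⟩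
  · rw [hd]
    exact Unimodular.vecMul ⟨x, hx⟩ he
  · have : reducedBlock G (g + G *ᵥ z) b (c + b ⬝ᵥ z) r (y + z - (r ⬝ᵥ y) • z) =
        reducedBlock G g b c r y * (1 + vecMulVec z r) := by
      have hdz : (b + c • r) ⬝ᵥ z = b ⬝ᵥ z := by
        rw [add_dotProduct, smul_dotProduct, hrz, smul_zero, add_zero]
      rw [reducedBlock_eq, reducedBlock_eq]
      simp only [mul_add, add_mul, mul_one, mul_vecMulVec, vecMulVec_mulVec, op_smul_eq_smul,
        smul_mul_assoc, mulVec_add, mulVec_sub, mulVec_smul, dotProduct_add, dotProduct_sub,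
        dotProduct_smul, hrz, hdz]
      ext i j
      simp only [Matrix.add_apply, Matrix.smul_apply, vecMulVec_apply, Pi.add_apply, Pi.sub_apply,
        Pi.smul_apply, smul_eq_mul]
      ring
    rw [this]
    exact hK.mul he

/-- The condition `ReducesToElementary` for the blocks of a matrix. -/
def Matrix.LastReducesToElementary {n : ℕ} (M : Matrix (Fin (n + 1)) (Fin (n + 1)) R) : Prop :=
  ReducesToElementary (M.submatrix Fin.castSucc Fin.castSucc) (fun i => M i.castSucc (Fin.last n))
    (fun j => M (Fin.last n) j.castSucc) (M (Fin.last n) (Fin.last n))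

theorem StableRangeCond.lastReducesToElementary_mul_transvection {m : ℕ}
    (h : StableRangeCond R m) {M : Matrix (Fin (m + 2)) (Fin (m + 2)) R}
    (hM : M.LastReducesToElementary) {i j : Fin (m + 2)} (hij : i ≠ j) (s : R) :
    (M * (1 + single i j s)).LastReducesToElementary := by
  have key (a b : Fin (m + 2)) :
      (M * (1 + single i j s)) a b = M a b + if j = b then M a i * s else 0 := by
    rw [mul_add, mul_one, Matrix.add_apply]
    congr 1
    split_ifs with hb
    · subst hb
      simp
    · simp [mul_single_apply_of_ne, Ne.symm hb]
  rw [Matrix.LastReducesToElementary] at hM ⊢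
  revert hij key
  refine Fin.lastCases ?_ (fun i => ?_) i <;> refine Fin.lastCases ?_ (fun j => ?_) j <;>
    intro hij key
  · exact absurd rfl hij
  · convert hM.add_last_col (Pi.single j s) using 1
    · ext a b
      simp [key, vecMulVec_apply, Pi.single_apply, eq_comm]
    · ext a
      simp [key]
    · ext b
      simp [key, Pi.single_apply, eq_comm]
    · simp [key]
  · convert h.reducesToElementary_add_col hM i s using 1
    · ext a b
      simp [key, eq_comm, Fin.castSucc_ne_last]
    · ext a
      simp [key, mul_comm]
    · ext b
      simp [key, eq_comm, Fin.castSucc_ne_last]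
    · simp [key]
  · have hij' : i ≠ j := fun e => hij (congrArg _ e)
    have he : IsElementary (1 + single i j s) :=
      ⟨_, SLStable.transvection_mem hij' s, Matrix.SpecialLinearGroup.transvection_coe hij' s⟩
    convert hM.mul_left_block he using 1
    · ext a b
      rw [submatrix_apply, key, mul_add, mul_one, Matrix.add_apply]
      by_cases hb : j = b
      · subst hb
        simp
      · simp [mul_single_apply_of_ne, Ne.symm hb, hb]
    · ext a
      simp [key, Fin.castSucc_ne_last]
    · ext b
      rw [key, vecMul_add, vecMul_one]
      by_cases hb : j = b
      · subst hb
        simp [vecMul, dotProduct, single_apply]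
      · simp [vecMul, dotProduct, hb]
    · simp [key, Fin.castSucc_ne_last]

/-- Injective stability: an element of `SL_n(R)` which becomes elementary in `SL_{n+1}(R)` is
elementary if `n - 1` lies in the stable range. -/
theorem StableRangeCond.mem_elementaryGroup_of_extend_mem {m : ℕ} (h : StableRangeCond R m)
    {A : Matrix.SpecialLinearGroup (Fin (m + 1)) R}
    (hA : SLStable.extend (Nat.le_succ (m + 1)) A ∈ elementaryGroup R (m + 2)) :
    A ∈ elementaryGroup R (m + 1) := by
  -- For the last row (0, …, 0, 1) the choice r = 0 would give the zero row. Taking r = e_0 and y =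
  -- 0 is admissible, and leaves the upper left block alone when g = 0. This serves both the
  -- identity and diag(A, 1).
  have hu : Unimodular ((0 : Fin (m + 1) → R) + (1 : R) • Pi.single 0 1) :=
    ⟨Pi.single 0 1, by simp⟩
  have red {g : Matrix.SpecialLinearGroup (Fin (m + 2)) R} (hg : g ∈ elementaryGroup R (m + 2)) :
      Matrix.LastReducesToElementary (g : Matrix (Fin (m + 2)) (Fin (m + 2)) R) := by
    have hinv {i j : Fin (m + 2)} (hij : i ≠ j) (s : R) :
        (Matrix.SpecialLinearGroup.transvection hij s)⁻¹ =
          Matrix.SpecialLinearGroup.transvection hij (-s) := by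
      rw [inv_eq_iff_mul_eq_one]
      apply Subtype.ext
      rw [Matrix.SpecialLinearGroup.coe_mul, Matrix.SpecialLinearGroup.transvection_coe,
        Matrix.SpecialLinearGroup.transvection_coe, mul_add, add_mul, add_mul,
        single_mul_single_of_ne _ _ _ _ hij.symm, add_zero, mul_one, mul_one, one_mul, add_assoc,
        ← single_add, add_neg_cancel, single_zero, add_zero, Matrix.SpecialLinearGroup.coe_one]
    induction hg using Subgroup.closure_induction_right with
    | one =>
      refine ⟨Pi.single 0 1, 0, ?_, ?_, ?_⟩
      · convert hu using 2
        · ext j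
          simp [one_apply, (Fin.castSucc_ne_last _).symm]
        · simp
      · simp
      · convert IsElementary.one using 1
        ext i j
        simp [reducedBlock_eq, one_apply, vecMulVec_apply, Fin.castSucc_ne_last,
          (Fin.castSucc_ne_last _).symm]
    | mul_right x hx y hy ih =>
      obtain ⟨i, j, hij, s, rfl⟩ := hy
      rw [Matrix.SpecialLinearGroup.coe_mul, Matrix.SpecialLinearGroup.transvection_coe]
      exact h.lastReducesToElementary_mul_transvection ih hij s
    | mul_inv_cancel x hx y hy ih =>
      obtain ⟨i, j, hij, s, rfl⟩ := hy
      rw [hinv, Matrix.SpecialLinearGroup.coe_mul, Matrix.SpecialLinearGroup.transvection_coe]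
      exact h.lastReducesToElementary_mul_transvection ih hij (-s)
  have hred := red hA
  rw [Matrix.LastReducesToElementary] at hred
  simp only [SLStable.extend_castSucc_last, SLStable.extend_last_castSucc,
    SLStable.extend_last_last] at hred
  obtain ⟨g, hg, e⟩ := h.isElementary_reducedBlock hred (r := Pi.single 0 1) (y := 0) hu (by simp)
  have : g = A := by
    apply Subtype.ext
    rw [e]
    ext i j
    simp [reducedBlock_eq, vecMulVec_apply, SLStable.extend_castSucc]
  rwa [← this]

end InjectiveStability

/-! ### Column reduction of right invertible matrices -/

section Reduction

variable {R : Type u} [CommRing R]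

/-- The block matrix `diag(1, A)`. -/
def borderOne {n : ℕ} (A : Matrix (Fin n) (Fin n) R) : Matrix (Fin (n + 1)) (Fin (n + 1)) R :=
  Matrix.of (Fin.cons (Fin.cons 1 0) fun i => Fin.cons 0 (A i))

section

variable {n : ℕ} (A : Matrix (Fin n) (Fin n) R) (i j : Fin n)

@[simp]
theorem borderOne_zero_zero : borderOne A 0 0 = 1 := rfl

@[simp]
theorem borderOne_zero_succ : borderOne A 0 j.succ = 0 := rfl

@[simp]
theorem borderOne_succ_zero : borderOne A i.succ 0 = 0 := rfl

@[simp]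
theorem borderOne_succ_succ : borderOne A i.succ j.succ = A i j := rfl

end

theorem borderOne_one {n : ℕ} : borderOne (1 : Matrix (Fin n) (Fin n) R) = 1 := by
  ext i j
  refine Fin.cases ?_ (fun i => ?_) i <;> refine Fin.cases ?_ (fun j => ?_) j <;>
    simp [one_apply, Fin.succ_ne_zero, (Fin.succ_ne_zero _).symm]

theorem borderOne_mul {n : ℕ} (A B : Matrix (Fin n) (Fin n) R) :
    borderOne (A * B) = borderOne A * borderOne B := by
  ext i j
  refine Fin.cases ?_ (fun i => ?_) i <;> refine Fin.cases ?_ (fun j => ?_) j <;>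
    simp [mul_apply, Fin.sum_univ_succ]

theorem det_borderOne {n : ℕ} (A : Matrix (Fin n) (Fin n) R) : (borderOne A).det = A.det := by
  rw [det_succ_row_zero, Fin.sum_univ_succ]
  have : (borderOne A).submatrix Fin.succ Fin.succ = A := rfl
  simp [this]

theorem IsElementary.borderOne {n : ℕ} {A : Matrix (Fin n) (Fin n) R} (hA : IsElementary A) :
    IsElementary (borderOne A) := by
  have gen {i j : Fin n} (hij : i ≠ j) (s : R) : _root_.borderOne (1 + single i j s) =
      (Matrix.SpecialLinearGroup.transvection ((Fin.succ_injective n).ne hij) s :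
        Matrix.SpecialLinearGroup (Fin (n + 1)) R) := by
    rw [Matrix.SpecialLinearGroup.transvection_coe]
    ext a b
    refine Fin.cases ?_ (fun a => ?_) a <;> refine Fin.cases ?_ (fun b => ?_) b <;>
      simp [one_apply, single_apply, Fin.succ_ne_zero, (Fin.succ_ne_zero _).symm]
  obtain ⟨g, hg, rfl⟩ := hA
  induction hg using Subgroup.closure_induction with
  | one => rw [Matrix.SpecialLinearGroup.coe_one, borderOne_one]; exact one
  | mem x hx =>
    obtain ⟨i, j, hij, s, rfl⟩ := hx
    rw [Matrix.SpecialLinearGroup.transvection_coe, gen hij]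
    exact ⟨_, SLStable.transvection_mem _ s, rfl⟩
  | mul x y hx hy ihx ihy =>
    rw [Matrix.SpecialLinearGroup.coe_mul, borderOne_mul]
    exact ihx.mul ihy
  | inv x hx ih =>
    obtain ⟨N, hN, -, h⟩ := ih.exists_inv
    suffices _root_.borderOne ((x⁻¹ : Matrix.SpecialLinearGroup (Fin n) R) : Matrix _ _ R) = N by
      rwa [this]
    rw [← mul_one N, ← borderOne_one, ← Matrix.SpecialLinearGroup.coe_one, ← mul_inv_cancel x,
      Matrix.SpecialLinearGroup.coe_mul, borderOne_mul, ← mul_assoc, h, one_mul]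

variable (R) in
/-- The `l × n` matrix with entries `1` on the diagonal and `0` elsewhere. -/
def rectOne (l n : ℕ) : Matrix (Fin l) (Fin n) R :=
  Matrix.of fun i j => if (i : ℕ) = j then 1 else 0

/-- Induction on the number of rows: reduce the first row, treat the complementary block, then clear
the first column. The class `P` is left abstract because the reduction is needed both inside E_n(R)
and inside SL_n(R), with different bounds `s`. -/
theorem exists_mul_eq_rectOne (P : ∀ n, Matrix (Fin n) (Fin n) R → Prop)
    (hmul : ∀ n A B, P n A → P n B → P n (A * B)) (hinv : ∀ n A, P n A → ∃ B, A * B = 1)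
    (helem : ∀ n A, IsElementary A → P n A) (hborder : ∀ n A, P n A → P (n + 1) (borderOne A))
    {s : ℕ} (hrow : ∀ n, s ≤ n → ∀ a : Fin (n + 1) → R, Unimodular a →
      ∃ e, P (n + 1) e ∧ a ᵥ* e = Pi.single 0 1) (l n : ℕ) (hn : l + s ≤ n)
    (M : Matrix (Fin l) (Fin n) R) (B : Matrix (Fin n) (Fin l) R) (hMB : M * B = 1) :
    ∃ e : Matrix (Fin n) (Fin n) R, P n e ∧ M * e = rectOne R l n := by
  induction l generalizing n with
  | zero => exact ⟨1, helem _ _ .one, Subsingleton.elim _ _⟩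
  | succ l ih =>
    obtain ⟨n, rfl⟩ := Nat.exists_eq_add_one.2 (by omega : 0 < n)
    obtain ⟨e, he, hMe⟩ := hrow n (by omega) (M 0)
      ⟨fun k => B k 0, by simpa [mul_apply, dotProduct] using congrFun (congrFun hMB 0) 0⟩
    obtain ⟨f, hf⟩ := hinv _ _ he
    have h1 : (M * e) * (f * B) = 1 := by
      rw [Matrix.mul_assoc, ← Matrix.mul_assoc e, hf, Matrix.one_mul, hMB]
    have h0 : (M * e) 0 = Pi.single 0 1 := by
      rw [← hMe]
      rfl
    generalize hM' : M * e = M' at h0 h1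
    generalize f * B = C at h1
    -- As the first row of `M'` is (1, 0, …, 0), the first row of `M' * C = 1` is that of `C`. Hence
    -- the lower right block of `C` is a right inverse of that of `M'`.
    have hC (j : Fin l) : C 0 j.succ = 0 := by
      have := congrFun (congrFun h1 0) j.succ
      rw [mul_apply, h0] at this
      simpa [Pi.single_apply, one_apply, (Fin.succ_ne_zero _).symm] using this
    obtain ⟨e', he', h'⟩ := ih n (by omega) (M'.submatrix Fin.succ Fin.succ)
      (C.submatrix Fin.succ Fin.succ) (by
        ext i j
        have := congrFun (congrFun h1 i.succ) j.succ
        simpa [mul_apply, Fin.sum_univ_succ, hC, one_apply] using this)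
    -- Only the first `l` columns of the reduced block carry a pivot; each is used to clear one
    -- entry of column 0.
    let c : Fin (n + 1) → R := Fin.cons 0 fun k =>
      if h : (k : ℕ) < l then -M' (Fin.succ ⟨k, h⟩) 0 else 0
    refine ⟨e * borderOne e' * (1 + vecMulVec c (Pi.single 0 1)),
      hmul _ _ _ (hmul _ _ _ he (hborder _ _ he')) (helem _ _ (.colShear 0 rfl)), ?_⟩
    have h2 : M' * borderOne e' = Matrix.of (Fin.cons (Pi.single 0 1)
        fun i => Fin.cons (M' i.succ 0) (rectOne R l n i)) := by
      ext i j
      refine Fin.cases ?_ (fun i => ?_) i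
      · rw [mul_apply, h0]
        refine Fin.cases ?_ (fun j => ?_) j <;> simp [Pi.single_apply]
      · rw [mul_apply, Fin.sum_univ_succ]
        refine Fin.cases ?_ (fun j => ?_) j
        · simp
        · rw [← h']
          simp [mul_apply]
    rw [← Matrix.mul_assoc, ← Matrix.mul_assoc, hM', h2, Matrix.mul_add, Matrix.mul_one, mul_vecMulVec]
    ext i j
    refine Fin.cases ?_ (fun i => ?_) i
    · refine Fin.cases ?_ (fun j => ?_) j <;>
        simp [rectOne, vecMulVec_apply, c, mulVec, dotProduct, Pi.single_apply]
    · have hc : (rectOne R l n *ᵥ fun k => c k.succ) i = -M' i.succ 0 := by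
        have hi : (i : ℕ) < n := by omega
        have hck : c (Fin.succ ⟨i, hi⟩) = -M' i.succ 0 := dif_pos i.2
        rw [mulVec, dotProduct, Finset.sum_eq_single (⟨i, hi⟩ : Fin n)]
        · rw [hck]
          simp [rectOne]
        · intro k _ hk
          have : (i : ℕ) ≠ k := fun e => hk (Fin.ext e.symm)
          simp [rectOne, this]
        · simp
      rw [mulVec, dotProduct] at hc
      refine Fin.cases ?_ (fun j => ?_) j
      · rw [Matrix.add_apply, vecMulVec_apply, mulVec, dotProduct, Fin.sum_univ_succ]
        change M' i.succ 0 + (M' i.succ 0 * c 0 + ∑ k, rectOne R l n i k * c k.succ) * _ = _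
        rw [hc]
        simp [c, rectOne]
      · simp [rectOne, vecMulVec_apply]

theorem StableRangeCond.exists_isElementary_mul_eq_rectOne {s : ℕ} (h : StableRangeCond R s)
    {l n : ℕ} (hn : l + s ≤ n) {M : Matrix (Fin l) (Fin n) R} {B : Matrix (Fin n) (Fin l) R}
    (hMB : M * B = 1) : ∃ e : Matrix (Fin n) (Fin n) R, IsElementary e ∧ M * e = rectOne R l n :=
  exists_mul_eq_rectOne (fun _ => IsElementary) (fun _ _ _ => .mul)
    (fun _ _ hA => hA.exists_inv.imp fun _ h => h.2.1) (fun _ _ => id) (fun _ _ => .borderOne)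
    (fun _ hn _ => (h.mono hn).exists_isElementary_vecMul_eq) l n hn M B hMB

theorem StableRangeCond.exists_det_eq_one_mul_eq_rectOne (h : StableRangeCond R 2)
    {l n : ℕ} (hn : l + 1 ≤ n) {M : Matrix (Fin l) (Fin n) R} {B : Matrix (Fin n) (Fin l) R}
    (hMB : M * B = 1) : ∃ e : Matrix (Fin n) (Fin n) R, e.det = 1 ∧ M * e = rectOne R l n := by
  have helem (n : ℕ) (A : Matrix (Fin n) (Fin n) R) (hA : IsElementary A) : A.det = 1 := by
    obtain ⟨g, -, rfl⟩ := hA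
    exact g.2
  refine exists_mul_eq_rectOne (fun _ A => A.det = 1)
    (fun _ _ _ h1 h2 => by rw [det_mul, h1, h2, one_mul])
    (fun _ A hA => ⟨A⁻¹, mul_nonsing_inv A (by rw [hA]; exact isUnit_one)⟩) helem
    (fun _ _ hA => by rw [det_borderOne, hA]) ?_ l n hn M B hMB
  intro n hn a ha
  rcases hn.eq_or_lt with rfl | hn
  · obtain ⟨x, hx⟩ := ha
    rw [dotProduct, Fin.sum_univ_two] at hx
    -- The first column is inverse to the row `a`, the second is annihilated by it; the determinant
    -- is again `a ⬝ᵥ x`.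
    refine ⟨!![x 0, -a 1; x 1, a 0], ?_, ?_⟩
    · rw [det_fin_two_of, ← hx]
      ring
    · ext j
      fin_cases j
      · simpa [vecMul, dotProduct] using hx
      · simp only [vecMul, dotProduct]
        simp
        ring
  · obtain ⟨e, he, hae⟩ := (h.mono hn).exists_isElementary_vecMul_eq ha
    exact ⟨e, helem _ _ he, hae⟩

end Reduction

/-! ### Generating vectors of R^l as matrices -/

namespace GenVec

variable {R : Type u} [CommRing R] {l n : ℕ}

/-- The matrix whose columns are the entries of a generating vector of `R^l`. -/
def toMatrix (m : GenVec R (Fin l → R) n) : Matrix (Fin l) (Fin n) R :=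
  Matrix.of fun i j => m.vec j i

theorem toMatrix_injective :
    Function.Injective (toMatrix : GenVec R (Fin l → R) n → Matrix (Fin l) (Fin n) R) :=
  fun _ _ h => GenVec.ext (funext fun j => funext fun i => congrFun (congrFun h i) j)

theorem exists_toMatrix_mul_eq_one (m : GenVec R (Fin l → R) n) : 
    ∃ B : Matrix (Fin n) (Fin l) R, m.toMatrix * B = 1 := by
  have h (j : Fin l) : (Pi.single j 1 : Fin l → R) ∈ Submodule.span R (Set.range m.vec) := by
    rw [m.span_eq_top]
    trivial
  simp only [Submodule.mem_span_range_iff_exists_fun] at h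
  choose c hc using h
  refine ⟨Matrix.of fun k j => c j k, ?_⟩
  ext i j
  have := congrFun (hc j) i
  rw [Finset.sum_apply] at this
  rw [mul_apply, one_apply]
  simpa [toMatrix, mul_comm, Pi.single_apply] using this

theorem toMatrix_op_smul (g : Matrix.SpecialLinearGroup (Fin n) R) (m : GenVec R (Fin l → R) n) :
    (MulOpposite.op g • m).toMatrix = m.toMatrix * (g : Matrix (Fin n) (Fin n) R) := by
  ext i j
  change (MulOpposite.op g • m).vec j i = _
  rw [op_smul_vec, rowMul, Finset.sum_apply, mul_apply]
  exact Finset.sum_congr rfl fun k _ => mul_comm _ _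

theorem toModE_eq_iff {m m' : GenVec R (Fin l → R) n} :
    m.toModE = m'.toModE ↔ ∃ e : Matrix (Fin n) (Fin n) R,
      IsElementary e ∧ m.toMatrix = m'.toMatrix * e := by
  rw [toModE, toModE, Quotient.eq]
  rw [MulAction.orbitRel_apply]
  constructor
  · rintro ⟨⟨g, hg⟩, rfl⟩
    exact ⟨_, ⟨g.unop, hg, rfl⟩, toMatrix_op_smul g.unop m'⟩
  · rintro ⟨_, ⟨g, hg, rfl⟩, h⟩
    exact ⟨⟨MulOpposite.op g, hg⟩, toMatrix_injective ((toMatrix_op_smul g m').trans h.symm)⟩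

theorem toMatrix_unitFrame (u : Rˣ) : (unitFrame R n u).toMatrix =
    diagonal fun j : Fin n => if (j : ℕ) = 0 then (u : R) else 1 := by
  ext i j
  change (Pi.single j (if (j : ℕ) = 0 then (u : R) else 1) : Fin n → R) i = _
  by_cases h : i = j
  · subst h
    simp
  · simp [h]

theorem toMatrix_paddedFrame : (paddedFrame R n).toMatrix = rectOne R n (n + 1) := by
  ext i j
  change (Fin.snoc (fun j : Fin n => (Pi.single j 1 : Fin n → R)) 0 : Fin (n + 1) → Fin n → R) j i
    = if (i : ℕ) = j then 1 else 0
  refine Fin.lastCases ?_ (fun j => ?_) j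
  · simp [i.2.ne]
  · simp [Pi.single_apply, Fin.ext_iff]

/-- `E_n(R)` acts transitively on `V_n(R^l)` if `n - l` lies in the stable range. -/
theorem isPretransitive_elementaryGroup {s : ℕ} (h : StableRangeCond R s) (hn : l + s ≤ n) :
    MulAction.IsPretransitive (elementaryGroup R n).op (GenVec R (Fin l → R) n) where
  exists_smul_eq m m' := by
    obtain ⟨B, hB⟩ := m.exists_toMatrix_mul_eq_one
    obtain ⟨B', hB'⟩ := m'.exists_toMatrix_mul_eq_one
    obtain ⟨e, he, hme⟩ := h.exists_isElementary_mul_eq_rectOne hn hB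
    obtain ⟨e', he', hme'⟩ := h.exists_isElementary_mul_eq_rectOne hn hB'
    obtain ⟨f, hf, hef, -⟩ := he'.exists_inv
    obtain ⟨g, hg, hge⟩ := he.mul hf
    have h : m.toMatrix * (g : Matrix (Fin n) (Fin n) R) = m'.toMatrix := by
      have h1 : m.toMatrix * (e * f) = rectOne R l n * f := by rw [← Matrix.mul_assoc, hme]
      rw [hge, h1, ← hme', Matrix.mul_assoc, hef, Matrix.mul_one]
    exact ⟨⟨MulOpposite.op g, hg⟩, toMatrix_injective ((toMatrix_op_smul g m).trans h)⟩

end GenVec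

/-! ### Comparison of SL_n(R) / E_n(R) with SK_1(R) -/

section Stability

variable {R : Type u} [CommRing R]

namespace SLStable

theorem extend_mem_elementaryGroup {m n : ℕ} (h : m ≤ n)
    {g : Matrix.SpecialLinearGroup (Fin m) R} (hg : g ∈ elementaryGroup R m) :
    extend h g ∈ elementaryGroup R n := by
  suffices elementaryGroup R m ≤ (elementaryGroup R n).comap (extend h) from this hg
  rw [elementaryGroup, Subgroup.closure_le]
  rintro _ ⟨i, j, hij, r, rfl⟩
  change extend h _ ∈ elementaryGroup R n
  rw [extend_transvection]
  exact transvection_mem _ _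

theorem mem_elementaryGroup_of_extend_mem {m n : ℕ} (hR : StableRangeCond R m) (h : m + 1 ≤ n)
    {A : Matrix.SpecialLinearGroup (Fin (m + 1)) R} (hA : extend h A ∈ elementaryGroup R n) :
    A ∈ elementaryGroup R (m + 1) := by
  induction n, h using Nat.le_induction with
  | base =>
    rwa [show extend le_rfl A = A from DirectedSystem.map_self (f := fun _ _ h => extend h) A] at hA
  | succ n hn ih =>
    obtain ⟨n, rfl⟩ := Nat.exists_eq_add_one.2 (by omega : 0 < n)
    refine ih ((hR.mono (by omega : m ≤ n)).mem_elementaryGroup_of_extend_mem ?_)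
    rwa [show extend (Nat.le_succ (n + 1)) (extend hn A) = extend _ A from
      DirectedSystem.map_map (f := fun _ _ h => extend h) hn (Nat.le_succ _) A]

end SLStable

/-- The images of the E_n(R) form an ascending chain, so their supremum is their union. -/
theorem mem_stableE_iff {x : StableSL R} :
    x ∈ stableE R ↔ ∃ n, ∃ g ∈ elementaryGroup R n, StableSL.of R n g = x := by
  rw [stableE, Subgroup.mem_iSup_of_directed]
  · rfl
  · refine (monotone_nat_of_le_succ fun n => ?_).directed_le
    rintro _ ⟨g, hg, rfl⟩
    exact ⟨SLStable.extend (Nat.le_succ n) g, SLStable.extend_mem_elementaryGroup _ hg,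
      SLStable.of_extend _ _⟩

namespace SK1

theorem ofSL_extend {m n : ℕ} (h : m ≤ n) (A : Matrix.SpecialLinearGroup (Fin m) R) :
    SK1.ofSL R n (SLStable.extend h A) = SK1.ofSL R m A :=
  congrArg (QuotientGroup.mk' (stableE R)) (SLStable.of_extend h A)

theorem ofSL_eq_one_of_mem {n : ℕ} {g : Matrix.SpecialLinearGroup (Fin n) R}
    (hg : g ∈ elementaryGroup R n) : SK1.ofSL R n g = 1 :=
  (QuotientGroup.eq_one_iff _).2 (mem_stableE_iff.2 ⟨n, g, hg, rfl⟩)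

/-- A matrix of trivial class coincides, in some larger SL_k(R), with the stabilization of an
elementary matrix; injective stability brings it back down. -/
theorem ofSL_eq_one_iff {m : ℕ} (h : StableRangeCond R m)
    {g : Matrix.SpecialLinearGroup (Fin (m + 1)) R} :
    SK1.ofSL R (m + 1) g = 1 ↔ g ∈ elementaryGroup R (m + 1) := by
  refine ⟨fun hg => ?_, ofSL_eq_one_of_mem⟩
  obtain ⟨n, e, he, hge⟩ := mem_stableE_iff.1 ((QuotientGroup.eq_one_iff _).1 hg)
  obtain ⟨k, hn, hm, hk⟩ := Quotient.exact hge
  exact SLStable.mem_elementaryGroup_of_extend_mem h hm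
    (hk ▸ SLStable.extend_mem_elementaryGroup hn he)

theorem ofSL_eq_iff {m : ℕ} (h : StableRangeCond R m)
    {g g' : Matrix.SpecialLinearGroup (Fin (m + 1)) R} :
    SK1.ofSL R (m + 1) g = SK1.ofSL R (m + 1) g' ↔ g'⁻¹ * g ∈ elementaryGroup R (m + 1) := by
  rw [← ofSL_eq_one_iff h, map_mul, map_inv, inv_mul_eq_one, eq_comm]

/-- Surjective stability, one step. -/
theorem exists_ofSL_eq_ofSL_succ {n : ℕ} (h : StableRangeCond R n)
    (A : Matrix.SpecialLinearGroup (Fin (n + 1)) R) :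
    ∃ B, SK1.ofSL R n B = SK1.ofSL R (n + 1) A := by
  obtain ⟨e, he, hAe⟩ := h.exists_isElementary_vecMul_eq (a := A (Fin.last n))
    ⟨fun k => (A⁻¹ : Matrix.SpecialLinearGroup (Fin (n + 1)) R) k (Fin.last n), by
      have h1 : (A : Matrix (Fin (n + 1)) (Fin (n + 1)) R) *
          (A⁻¹ : Matrix.SpecialLinearGroup (Fin (n + 1)) R) = 1 := by
        rw [← Matrix.SpecialLinearGroup.coe_mul, mul_inv_cancel,
          Matrix.SpecialLinearGroup.coe_one]
      simpa [mul_apply, dotProduct] using congrFun (congrFun h1 (Fin.last n)) (Fin.last n)⟩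
  -- Row reduction ends at the first coordinate row, but the last row of `A` should become the last
  -- one; the reduction of the latter is therefore run backwards.
  obtain ⟨e', he', hAe'⟩ := h.exists_isElementary_vecMul_eq (a := Pi.single (Fin.last n) (1 : R))
    ⟨Pi.single (Fin.last n) 1, by simp⟩
  obtain ⟨f, hf, hef, -⟩ := he'.exists_inv
  obtain ⟨g, hg, hge⟩ := he.mul hf
  have hlast : (A * g : Matrix.SpecialLinearGroup (Fin (n + 1)) R) (Fin.last n) =
      Pi.single (Fin.last n) 1 := by
    rw [Matrix.SpecialLinearGroup.coe_mul, hge]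
    change A (Fin.last n) ᵥ* (e * f) = _
    rw [← vecMul_vecMul, hAe, ← hAe', vecMul_vecMul, hef, vecMul_one]
  have hA : SK1.ofSL R (n + 1) A = SK1.ofSL R (n + 1) (A * g) := by
    rw [map_mul, ofSL_eq_one_of_mem hg, mul_one]
  rw [hA]
  generalize A * g = C at hlast
  have hdet : ((C : Matrix (Fin (n + 1)) (Fin (n + 1)) R).submatrix
      Fin.castSucc Fin.castSucc).det = 1 := by
    have hC := C.2
    rw [det_succ_row _ (Fin.last n), Finset.sum_eq_single (Fin.last n)] at hC
    · rw [hlast] at hC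
      simpa [← two_mul, pow_mul, Fin.succAbove_last] using hC
    · intro j _ hj
      rw [hlast]
      simp [hj]
    · simp
  obtain ⟨k, hk, hkC⟩ := IsElementary.colShear (Fin.last n)
    (c := Fin.snoc (fun i => C i.castSucc (Fin.last n)) 0) (by simp)
  obtain ⟨D, hD⟩ : ∃ D : Matrix.SpecialLinearGroup (Fin n) R,
      ∀ i j, D i j = C i.castSucc j.castSucc := ⟨⟨_, hdet⟩, fun _ _ => rfl⟩
  refine ⟨D, ?_⟩
  -- With last row (0, …, 0, 1), the matrix `C` is diag(D, 1) up to its last column, which the shear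
  -- `k` supplies.
  have : C = k * SLStable.extend (Nat.le_succ n) D := by
    apply Subtype.ext
    rw [Matrix.SpecialLinearGroup.coe_mul, hkC, add_mul, one_mul, vecMulVec_mul]
    have hrow : Pi.single (Fin.last n) 1 ᵥ* (SLStable.extend (Nat.le_succ n) D :
        Matrix (Fin (n + 1)) (Fin (n + 1)) R) = Pi.single (Fin.last n) 1 := by
      rw [single_one_vecMul]
      ext j
      refine Fin.lastCases ?_ (fun j => ?_) j
      · simpa using SLStable.extend_last_last _
      · simpa using SLStable.extend_last_castSucc _ _
    rw [hrow]
    ext i j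
    rw [Matrix.add_apply, vecMulVec_apply]
    refine Fin.lastCases ?_ (fun i => ?_) i
    · rw [hlast]
      refine Fin.lastCases ?_ (fun j => ?_) j
      · simp [SLStable.extend_last_last]
      · simp [SLStable.extend_last_castSucc]
    · refine Fin.lastCases ?_ (fun j => ?_) j
      · simp [SLStable.extend_castSucc_last]
      · simp [SLStable.extend_castSucc, hD]
  rw [this, map_mul, ofSL_eq_one_of_mem hk, one_mul, ofSL_extend]

theorem ofSL_surjective {n : ℕ} (h : StableRangeCond R n) :
    Function.Surjective (SK1.ofSL R n) := by
  have down (k : ℕ) (hk : n ≤ k) (A : Matrix.SpecialLinearGroup (Fin k) R) :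
      ∃ B, SK1.ofSL R n B = SK1.ofSL R k A := by
    induction k, hk using Nat.le_induction with
    | base => exact ⟨A, rfl⟩
    | succ k hk ih =>
      obtain ⟨B, hB⟩ := exists_ofSL_eq_ofSL_succ (h.mono hk) A
      rw [← hB]
      exact ih B
  intro q
  obtain ⟨x, rfl⟩ := QuotientGroup.mk_surjective q
  obtain ⟨k, A, rfl⟩ := DirectLimit.exists_eq_mk _ x
  obtain ⟨B, hB⟩ := down (max n k) (le_max_left n k) (SLStable.extend (le_max_right n k) A)
  exact ⟨B, hB.trans (ofSL_extend _ _)⟩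

end SK1

end Stability

theorem exists_stableRangeCond_of_stableRank_le {R : Type u} [CommRing R] {s : ℕ}
    (h : stableRank R R ≤ s) : 0 < s ∧ StableRangeCond R s := by
  have h' : stableRank R R < (s + 1 : ℕ) := h.trans_lt (by exact_mod_cast Nat.lt_succ_self s)
  simp only [stableRank, iInf_lt_iff] at h'
  obtain ⟨k, hk, hks⟩ := h'
  have hks : k < s + 1 := by exact_mod_cast hks
  exact ⟨hk.1.trans_le (by omega), hk.stableRangeCond.mono (by omega)⟩

theorem Function.Surjective.exists_equiv_of_eq_iff {X Y Z : Type*} {f : X → Y} {g : X → Z}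
    (hf : Function.Surjective f) (hg : Function.Surjective g)
    (h : ∀ x x', f x = f x' ↔ g x = g x') : ∃ Φ : Y ≃ Z, ∀ x, Φ (f x) = g x := by
  have key (x : X) : g (Function.surjInv hf (f x)) = g x := (h _ _).1 (Function.surjInv_eq hf _)
  refine ⟨Equiv.ofBijective (g ∘ Function.surjInv hf) ⟨fun y y' hy => ?_, fun z => ?_⟩, key⟩
  · have := (h _ _).2 hy
    rwa [Function.surjInv_eq hf, Function.surjInv_eq hf] at this
  · obtain ⟨x, rfl⟩ := hg z
    exact ⟨f x, key x⟩

/-! ### The orbit sets and the main theorem -/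

section Orbits

variable {R : Type u} [CommRing R]

theorem exists_equiv_units_prod_SK1 {m : ℕ} (h : StableRangeCond R m) :
    ∃ Φ : GenVec.ModE R (Fin (m + 1) → R) (m + 1) ≃ Rˣ × SK1 R,
      ∀ (u : Rˣ) (σ : Matrix.SpecialLinearGroup (Fin (m + 1)) R),
        Φ (MulOpposite.op σ • GenVec.unitFrame R (m + 1) u).toModE =
          (u, SK1.ofSL R (m + 1) σ) := by
  have hD (u : Rˣ) : (GenVec.unitFrame R (m + 1) u).toMatrix.det = u := by
    rw [GenVec.toMatrix_unitFrame, det_diagonal, Fin.prod_univ_succ]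
    simp
  have hinv (u : Rˣ) : (GenVec.unitFrame R (m + 1) u⁻¹).toMatrix *
      (GenVec.unitFrame R (m + 1) u).toMatrix = 1 := by
    rw [GenVec.toMatrix_unitFrame, GenVec.toMatrix_unitFrame, diagonal_mul_diagonal,
      ← diagonal_one]
    congr 1
    ext j
    split_ifs <;> simp
  have hinv' (u : Rˣ) : (GenVec.unitFrame R (m + 1) u).toMatrix *
      (GenVec.unitFrame R (m + 1) u⁻¹).toMatrix = 1 := by
    simpa using hinv u⁻¹
  refine (Function.Surjective.exists_equiv_of_eq_iff
    (f := fun p : Rˣ × Matrix.SpecialLinearGroup (Fin (m + 1)) R =>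
      (MulOpposite.op p.2 • GenVec.unitFrame R (m + 1) p.1).toModE)
    (g := fun p => (p.1, SK1.ofSL R (m + 1) p.2)) ?_ ?_ ?_).imp
    fun _ hΦ u σ => hΦ (u, σ)
  · intro q
    obtain ⟨v, rfl⟩ := Quotient.exists_rep q
    obtain ⟨B, hB⟩ := v.exists_toMatrix_mul_eq_one
    have hdet : v.toMatrix.det * B.det = 1 := by rw [← det_mul, hB, det_one]
    let u : Rˣ := Units.mkOfMulEqOne _ _ hdet
    have hσ : ((GenVec.unitFrame R (m + 1) u⁻¹).toMatrix * v.toMatrix).det = 1 := by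
      rw [det_mul, hD]
      exact u.inv_mul
    refine ⟨(u, ⟨_, hσ⟩), congrArg GenVec.toModE (GenVec.toMatrix_injective ?_)⟩
    rw [GenVec.toMatrix_op_smul]
    change _ * (_ * _) = _
    rw [← mul_assoc, hinv', one_mul]
  · rintro ⟨u, q⟩
    obtain ⟨σ, rfl⟩ := SK1.ofSL_surjective h.succ q
    exact ⟨(u, σ), rfl⟩
  · rintro ⟨u, σ⟩ ⟨v, τ⟩
    simp only [GenVec.toModE_eq_iff, GenVec.toMatrix_op_smul, Prod.mk.injEq, SK1.ofSL_eq_iff h]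
    constructor
    · rintro ⟨_, ⟨g, hg, rfl⟩, hge⟩
      have huv : u = v := by
        have := congrArg det hge
        rw [det_mul, det_mul, det_mul, hD, hD, σ.2, τ.2, g.2, mul_one, mul_one, mul_one] at this
        exact Units.ext this
      subst huv
      refine ⟨rfl, ?_⟩
      have hστ : σ = τ * g := by
        apply Subtype.ext
        have := congrArg ((GenVec.unitFrame R (m + 1) u⁻¹).toMatrix * ·) hge
        rwa [← mul_assoc, ← mul_assoc, ← mul_assoc, hinv, one_mul, one_mul] at this
      rwa [hστ, inv_mul_cancel_left]
    · rintro ⟨rfl, hg⟩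
      refine ⟨_, ⟨_, hg, rfl⟩, ?_⟩
      rw [mul_assoc, ← Matrix.SpecialLinearGroup.coe_mul, mul_inv_cancel_left]

/-- The first n rows are those of the identity, so the matrix is lower triangular; determinant 1
forces its last diagonal entry to be 1, and it is a row shear. -/
theorem mem_elementaryGroup_of_rectOne_mul_eq {n : ℕ}
    {g : Matrix.SpecialLinearGroup (Fin (n + 1)) R}
    (hg : rectOne R n (n + 1) * (g : Matrix (Fin (n + 1)) (Fin (n + 1)) R) =
      rectOne R n (n + 1)) : g ∈ elementaryGroup R (n + 1) := by
  have hrow (i : Fin n) (j : Fin (n + 1)) : g i.castSucc j = if i.castSucc = j then 1 else 0 := by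
    have := congrFun (congrFun hg i) j
    rw [mul_apply, Finset.sum_eq_single i.castSucc] at this
    · simpa [rectOne, Fin.ext_iff] using this
    · intro k _ hk
      have : (i : ℕ) ≠ k := fun e => hk (Fin.ext e.symm)
      simp [rectOne, this]
    · simp
  have hlast : g (Fin.last n) (Fin.last n) = 1 := by
    have := g.2
    rw [det_of_isLowerTriangular, Fin.prod_univ_castSucc] at this
    · simpa [hrow] using this
    · intro i j hij
      have hij : i < j := hij
      revert hij
      refine Fin.lastCases (fun hij => ?_) (fun i hij => ?_) i
      · exact absurd hij (Fin.le_last j).not_gt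
      · rw [hrow, if_neg hij.ne]
  obtain ⟨k, hk, hkg⟩ := IsElementary.rowShear (Fin.last n)
    (c := Fin.snoc (fun j => g (Fin.last n) j.castSucc) 0) (by simp)
  suffices g = k by rwa [this]
  apply Subtype.ext
  rw [hkg]
  ext i j
  rw [Matrix.add_apply, vecMulVec_apply, one_apply]
  refine Fin.lastCases ?_ (fun i => ?_) i
  · refine Fin.lastCases ?_ (fun j => ?_) j
    · simpa using hlast
    · simp [(Fin.castSucc_ne_last _).symm]
  · simpa [Fin.castSucc_ne_last] using hrow i j

theorem exists_equiv_SK1 {n : ℕ} (h : StableRangeCond R 2) (hn : 2 ≤ n) :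
    ∃ Φ : GenVec.ModE R (Fin n → R) (n + 1) ≃ SK1 R,
      ∀ σ : Matrix.SpecialLinearGroup (Fin (n + 1)) R,
        Φ (MulOpposite.op σ • GenVec.paddedFrame R n).toModE = SK1.ofSL R (n + 1) σ := by
  have hR := h.mono hn
  refine Function.Surjective.exists_equiv_of_eq_iff
    (f := fun σ : Matrix.SpecialLinearGroup (Fin (n + 1)) R =>
      (MulOpposite.op σ • GenVec.paddedFrame R n).toModE) ?_ (SK1.ofSL_surjective hR.succ) ?_
  · intro q
    obtain ⟨v, rfl⟩ := Quotient.exists_rep q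
    obtain ⟨B, hB⟩ := v.exists_toMatrix_mul_eq_one
    obtain ⟨e, he, hve⟩ := h.exists_det_eq_one_mul_eq_rectOne le_rfl hB
    let g : Matrix.SpecialLinearGroup (Fin (n + 1)) R := ⟨e, he⟩
    have hg : e * (g⁻¹ : Matrix.SpecialLinearGroup (Fin (n + 1)) R) = 1 := by
      change (g : Matrix (Fin (n + 1)) (Fin (n + 1)) R) * _ = 1
      rw [← Matrix.SpecialLinearGroup.coe_mul, mul_inv_cancel, Matrix.SpecialLinearGroup.coe_one]
    refine ⟨g⁻¹, congrArg GenVec.toModE (GenVec.toMatrix_injective ?_)⟩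
    rw [GenVec.toMatrix_op_smul, GenVec.toMatrix_paddedFrame, ← hve, Matrix.mul_assoc, hg, Matrix.mul_one]
  · intro σ τ
    simp only [GenVec.toModE_eq_iff, GenVec.toMatrix_op_smul, GenVec.toMatrix_paddedFrame]
    constructor
    · rintro ⟨_, ⟨g, hg, rfl⟩, hge⟩
      -- Since `σ` and `τ * g` send the frame to the same vector, they differ on the left by an
      -- element of its stabilizer, whose class in SK_1(R) is trivial.
      have hρ : σ * (τ * g)⁻¹ ∈ elementaryGroup R (n + 1) := by
        apply mem_elementaryGroup_of_rectOne_mul_eq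
        rw [Matrix.SpecialLinearGroup.coe_mul, ← Matrix.mul_assoc, hge,
          Matrix.mul_assoc _ (τ : Matrix (Fin (n + 1)) (Fin (n + 1)) R),
          ← Matrix.SpecialLinearGroup.coe_mul, Matrix.mul_assoc, ← Matrix.SpecialLinearGroup.coe_mul,
          mul_inv_cancel, Matrix.SpecialLinearGroup.coe_one, Matrix.mul_one]
      have := SK1.ofSL_eq_one_of_mem hρ
      rwa [map_mul, map_inv, mul_inv_eq_one, map_mul, SK1.ofSL_eq_one_of_mem hg, mul_one] at this
    · intro hg
      refine ⟨_, ⟨_, (SK1.ofSL_eq_iff hR).1 hg, rfl⟩, ?_⟩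
      rw [Matrix.mul_assoc, ← Matrix.SpecialLinearGroup.coe_mul, mul_inv_cancel_left]

end Orbits

theorem mainTheorem5 (R : Type u) [CommRing R] (hR : IsHermiteRing R) :
    (∀ l n : ℕ, (l : ℕ∞) + stableRank R R - 1 < (n : ℕ∞) →
      MulAction.IsPretransitive (elementaryGroup R n).op (GenVec R (Fin l → R) n)) ∧
    (stableRank R R ≤ 2 →
      (∀ n : ℕ, 2 < n →
        ∃ Φ : GenVec.ModE R (Fin n → R) n ≃ Rˣ × SK1 R,
          ∀ (u : Rˣ) (σ : Matrix.SpecialLinearGroup (Fin n) R),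
            Φ (MulOpposite.op σ • GenVec.unitFrame R n u).toModE = (u, SK1.ofSL R n σ)) ∧
      (∀ n : ℕ, 2 ≤ n →
        ∃ Φ : GenVec.ModE R (Fin n → R) (n + 1) ≃ SK1 R,
          ∀ σ : Matrix.SpecialLinearGroup (Fin (n + 1)) R,
            Φ (MulOpposite.op σ • GenVec.paddedFrame R n).toModE = SK1.ofSL R (n + 1) σ)) := by
  refine ⟨fun l n hn => ?_, fun h => ?_⟩
  -- An infinite stable rank would make the lower bound on `n` infinite.
  · have hs : ∃ s : ℕ, stableRank R R = s := by
      refine ENat.ne_top_iff_exists.1 (fun h => ?_) |>.imp fun _ h => h.symm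
      rw [h] at hn
      simp at hn
    obtain ⟨s, hs⟩ := hs
    obtain ⟨hs0, hsr⟩ := exists_stableRangeCond_of_stableRank_le hs.le
    rw [hs] at hn
    have hn : l + s - 1 < n := by exact_mod_cast hn
    -- Positivity of `s` makes the truncated subtraction exact, so that `l + s ≤ n`.
    exact GenVec.isPretransitive_elementaryGroup hsr (by omega)
  · obtain ⟨-, h2⟩ := exists_stableRangeCond_of_stableRank_le (s := 2) h
    refine ⟨fun n hn => ?_, fun n hn => exists_equiv_SK1 h2 hn⟩
    obtain ⟨n, rfl⟩ := Nat.exists_eq_add_one.2 (by omega : 0 < n)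
    exact exists_equiv_units_prod_SK1 (h2.mono (by omega))
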